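/- Let $\mathbb D$ be the open unit disk and $dA=\pi^{-1}dx\,dy$. Let $\omega\ge 0$ be a radial weight on $\mathbb D$, i.e. $\omega$ is integrable on $\mathbb D$, $\omega(z)=\omega(|z|)$, and $\widehat\omega(r)=\int_r^1\omega(s)\,ds\neq 0$ for all $0\le r<1$. Assume that $\omega\in\mathcal D$ (two-sided doubling): there exist $C>0$ such that $\widehat\omega(r)\le C\,\widehat\omega\left(\frac{1+r}{2}\right)$ for all $0\le r<1$, and $K>1$, $C'>1$ such that $\widehat\omega(r)\ge C'\,\widehat\omega\left(1-\frac{1-r}{K}\right)$ for all $0\le r<1$. Let $A^2_\omega$ be the space of analytic functions $f$ on $\mathbb D$ with $\int_{\mathbb D}|f|^2\omega\,dA<\infty$. Let $X$ be either $C$, the space of continuous functions $\overline{\mathbb D}\to\mathbb C$, or $C_0$, its subspace of functions vanishing on $\partial\mathbb D$, with the supremum norm $\|\cdot\|_\infty$. Let $\mathcal B_0$ be the little Bloch space: the analytic functions $f$ on $\mathbb D$ with $$\|f\|_{\mathcal B}=\sup_{z\in\mathbb D}(1-|z|^2)|f'(z)|+|f(0)|<\infty\quad\text{and}\quad \lim_{|z|\to1^-}(1-|z|^2)|f'(z)|=0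 .$$ Then $A^2_\omega$ has a reproducing (Bergman) kernel $B^\omega_z\in A^2_\omega$ at every $z\in\mathbb D$, that is, $f(z)=\int_{\mathbb D}f\,\overline{B_z^\omega}\,\omega\,dA$ for all $f\in A^2_\omega$; the integral $$P_\omega\Phi(z)=\int_{\mathbb D}\Phi(\xi)\overline{B_z^\omega(\xi)}\,\omega(\xi)\,dA(\xi)$$ converges absolutely for all $\Phi\in X$ and $z\in\mathbb D$; and the Bergman projection $P_\omega$ maps $X$ boundedly onto $\mathcal B_0$: there is a constant $M$ such that $P_\omega\Phi\in\mathcal B_0$ and $\|P_\omega\Phi\|_{\mathcal B}\le M\|\Phi\|_\infty$ for all $\Phi\in X$, and every $h\in\mathcal B_0$ equals $P_\omega\Phi$ for some $\Phi\in X$. -/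

import Mathlib

open MeasureTheory Set Filter Topology Metric
open scoped NNReal ENNReal ComplexConjugate

noncomputable section

/-- Normalized area measure `dA = π⁻¹ dx dy` on the open unit disk. -/
def diskArea : Measure ℂ :=
  (ENNReal.ofReal Real.pi)⁻¹ • (volume.restrict (ball (0 : ℂ) 1))

/-- The tail integral `∫_r^1 ω(s) ds` of a radial function, as an extended non-negative number. -/
def weightTail (ω : ℂ → ℝ) (r : ℝ) : ℝ≥0∞ :=
  ∫⁻ s in Ioo r 1, ENNReal.ofReal (ω (s : ℂ))

/-- Radial weights on the unit disk, with nowhere vanishing tail integral. -/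
structure IsRadialWeight (ω : ℂ → ℝ) : Prop where
  nonneg : ∀ z ∈ ball (0 : ℂ) 1, 0 ≤ ω z
  integrable : Integrable ω diskArea
  radial : ∀ z ∈ ball (0 : ℂ) 1, ω z = ω ((‖z‖ : ℝ) : ℂ)
  tail_ne_zero : ∀ r ∈ Ico (0 : ℝ) 1, weightTail ω r ≠ 0

/-- The upper doubling condition. -/
def IsUpperDoubling (ω : ℂ → ℝ) : Prop :=
  ∃ C : ℝ, 0 < C ∧ ∀ r ∈ Ico (0 : ℝ) 1,
    weightTail ω r ≤ ENNReal.ofReal C * weightTail ω ((1 + r) / 2)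

/-- The lower (reverse) doubling condition. -/
def IsLowerDoubling (ω : ℂ → ℝ) : Prop :=
  ∃ K C : ℝ, 1 < K ∧ 1 < C ∧ ∀ r ∈ Ico (0 : ℝ) 1,
    ENNReal.ofReal C * weightTail ω (1 - (1 - r) / K) ≤ weightTail ω r

/-- Two-sided doubling radial weights. -/
structure IsDoublingWeight (ω : ℂ → ℝ) : Prop extends IsRadialWeight ω where
  upper : IsUpperDoubling ω
  lower : IsLowerDoubling ω

/-- Membership in the weighted Bergman space `A²_ω`. -/
def MemBergmanTwo (ω : ℂ → ℝ) (f : ℂ → ℂ) : Prop :=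
  DifferentiableOn ℂ f (ball 0 1) ∧ Integrable (fun ξ => ‖f ξ‖ ^ 2 * ω ξ) diskArea

/-- `k` is a reproducing kernel of `A²_ω` at the point `z`. -/
def IsReproducingKernelAt (ω : ℂ → ℝ) (z : ℂ) (k : ℂ → ℂ) : Prop :=
  MemBergmanTwo ω k ∧
    ∀ f : ℂ → ℂ, MemBergmanTwo ω f →
      f z = ∫ ξ, f ξ * conj (k ξ) * (ω ξ : ℂ) ∂diskArea

open Classical in
/-- The Bergman kernel `B_z^ω(ξ)`: the reproducing kernel of `A²_ω` at `z`. -/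
def bergmanKernel (ω : ℂ → ℝ) (z : ℂ) : ℂ → ℂ :=
  if h : ∃ k, IsReproducingKernelAt ω z k then h.choose else 0

/-- The integrand defining the Bergman projection. -/
def bergmanIntegrand (ω : ℂ → ℝ) (Φ : ℂ → ℂ) (z ξ : ℂ) : ℂ :=
  Φ ξ * conj (bergmanKernel ω z ξ) * (ω ξ : ℂ)

/-- The Bergman projection `P_ω`. -/
def bergmanProjection (ω : ℂ → ℝ) (Φ : ℂ → ℂ) (z : ℂ) : ℂ :=
  ∫ ξ, bergmanIntegrand ω Φ z ξ ∂diskArea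

/-- A continuous function on the closed disk, extended by zero to the plane. -/
def diskExtend (Φ : C(closedBall (0 : ℂ) 1, ℂ)) : ℂ → ℂ :=
  Function.extend Subtype.val Φ 0

/-- The space `C₀` of continuous functions on the closed disk with zero boundary values. -/
def diskCZero : Submodule ℂ C(closedBall (0 : ℂ) 1, ℂ) where
  carrier := {Φ | ∀ z : closedBall (0 : ℂ) 1, ‖(z : ℂ)‖ = 1 → Φ z = 0}
  add_mem' := by
    intro a b ha hb z hz
    simp [ha z hz, hb z hz]
  zero_mem' := by
    intro z _
    rfl
  smul_mem' := by
    intro c a ha z hz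
    simp [ha z hz]

/-- The Bloch norm `sup (1 - |z|²)|f'(z)| + |f(0)|`, possibly infinite. -/
def blochNorm (f : ℂ → ℂ) : ℝ≥0∞ :=
  (⨆ z ∈ ball (0 : ℂ) 1, ENNReal.ofReal ((1 - ‖z‖ ^ 2) * ‖deriv f z‖)) + ‖f 0‖ₑ

/-- The Bloch space. -/
def MemBloch (f : ℂ → ℂ) : Prop :=
  DifferentiableOn ℂ f (ball 0 1) ∧ blochNorm f < ∞

/-- The little Bloch space. -/
def MemLittleBloch (f : ℂ → ℂ) : Prop :=
  MemBloch f ∧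
    Tendsto (fun z : ℂ => (1 - ‖z‖ ^ 2) * ‖deriv f z‖) (comap norm (𝓝[<] (1 : ℝ))) (𝓝 0)

end

open MeasureTheory Set Filter Topology Metric
open scoped NNReal ENNReal ComplexConjugate

noncomputable section

/-! In polar coordinates `ω dA` is the product of `μ = 2tω(t) dt` on `(0,1)` with the normalized
angle. Monomials are therefore orthogonal, with squared norms the moments `m_n = ∫ t^(2n) dμ`, the
kernel is `B_z(ξ) = ∑ (conj z * ξ)^n / m_n`, and the `n`-th Taylor coefficient of `P_ω Φ` is `m_n⁻¹
∫ Φ conj(ξ)^n ω dA`. Everything else concerns the tail `T(r) = μ(r,∞)` and the moments of `μ`; both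
doubling conditions pass from `ω` to `T` (`IsDoublingWeight.isDoublingMeasure`).

Boundedness needs only the upper condition. With `G(w) = ∑ (n+1)/m_(n+1) w^n`, it suffices that `∫
|G(z conj ξ)| ω dA ≲ 1/(1-|z|)`. Write `G = H · 1/(1-w)`, where the coefficients of `H` are the
differences of `n/m_n`, hence `O(1/m_n)` (`exists_abs_coeff_sub_le`). On the circle `|w| = ρ`, the
inequality `|G| ≤ T(ρ)|H|² + T(ρ)⁻¹|1/(1-w)|²`, Parseval and `∑ ρ^(2n)/m_n² ≲ 1/((1-ρ)T(ρ)²)` bound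
the mean of `|G|` by a multiple of `1/((1-ρ)T(ρ))` (`exists_integral_norm_derivSeries_le`). A dyadic
argument integrates this against `μ` (`exists_lintegral_inv_tail_le`).

The image lies in the little Bloch space because the monomials in `ξ` and `conj ξ` project to
polynomials and span a dense subspace of `C` (`dense_span_monomials`).

Surjectivity is explicit. For `n ≥ 1`, `m_n = ∫ T(s) 2n s^(2n-1) ds`. The lower condition permits
moving the mass `T(s) ds` onto `μ`, over `t` in `(s, 1-(1-s)/K]`, with a density `κ(t,s)` between 0
and 2. Then `λ_n(t) t^(2n) = ∫_0^t κ(t,s) 2n s^(2n-1) ds` defines multipliers with `∫ λ_n t^(2n) dμ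
= m_n` (`integral_sweepMultiplier`), so the function with expansion `∑ h_n λ_n(|ξ|) ξ^n` over `n ≥
1` projects to `h - h(0)`. Summing the series gives `2ξ ∫_0^1 κ(t,xt) x h'(x²ξ) dx` with `t = |ξ|`.
The integrand lives on an interval of length `O(1-t)` in `x`, where `x²ξ` is near the circle, so the
little Bloch condition makes the integral tend to 0 at the boundary (`norm_sweep_le`). A multiple of
`1-|ξ|` supplies `h(0)`. The resulting preimage lies in `C₀`, which settles both choices of `X`. -/

/-! ### Fourier orthogonality and Parseval on circles -/

/-- Normalized angular measure on `(-π, π)`. -/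
def angleMeasure : Measure ℝ :=
  (ENNReal.ofReal (2 * Real.pi))⁻¹ • volume.restrict (Ioo (-Real.pi) Real.pi)

instance : IsProbabilityMeasure angleMeasure := by
  refine ⟨?_⟩
  simp only [angleMeasure, Measure.smul_apply, Measure.restrict_apply MeasurableSet.univ,
    univ_inter, Real.volume_Ioo, smul_eq_mul]
  rw [show Real.pi - -Real.pi = 2 * Real.pi by ring]
  exact ENNReal.inv_mul_cancel (by simp [Real.pi_pos]) ENNReal.ofReal_ne_top

/-- The point with polar coordinates `(t, θ)`. -/
def polarPoint (t θ : ℝ) : ℂ := t * Complex.exp (θ * Complex.I)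

@[fun_prop]
lemma Continuous.polarPoint {X : Type*} [TopologicalSpace X] {f g : X → ℝ} (hf : Continuous f)
    (hg : Continuous g) : Continuous fun x => polarPoint (f x) (g x) := by
  unfold _root_.polarPoint
  fun_prop

@[fun_prop]
lemma Measurable.polarPoint {X : Type*} [MeasurableSpace X] {f g : X → ℝ} (hf : Measurable f)
    (hg : Measurable g) : Measurable fun x => polarPoint (f x) (g x) := by
  unfold _root_.polarPoint
  fun_prop

@[simp]
lemma norm_polarPoint (t θ : ℝ) : ‖polarPoint t θ‖ = |t| := by
  simp [polarPoint, Complex.norm_exp_ofReal_mul_I]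

lemma polarPoint_pow_mul_conj_pow (t θ : ℝ) (m n : ℕ) :
    polarPoint t θ ^ m * conj (polarPoint t θ) ^ n =
      (t : ℂ) ^ (m + n) * Complex.exp (((m : ℤ) - n : ℤ) * θ * Complex.I) := by
  have h : conj (polarPoint t θ) = t * Complex.exp (-(θ * Complex.I)) := by
    simp [polarPoint, ← Complex.exp_conj]
  rw [h, polarPoint, mul_pow, mul_pow, ← Complex.exp_nat_mul, ← Complex.exp_nat_mul, pow_add]
  rw [show ((((m : ℤ) - n : ℤ) : ℂ) * θ * Complex.I) =
    m * (θ * Complex.I) + n * (-(θ * Complex.I)) by push_cast; ring, Complex.exp_add]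
  ring

lemma integral_angleMeasure_exp (k : ℤ) :
    ∫ θ, Complex.exp (k * θ * Complex.I) ∂angleMeasure = if k = 0 then 1 else 0 := by
  rcases eq_or_ne k 0 with rfl | hk
  · simp
  rw [if_neg hk, angleMeasure, integral_smul_measure, ← integral_Ioc_eq_integral_Ioo,
    ← intervalIntegral.integral_of_le (by linarith [Real.pi_pos])]
  have h : ∀ θ : ℝ, Complex.exp (k * θ * Complex.I) = Complex.exp ((k * Complex.I) * θ) := by
    intro θ; congr 1; ring
  simp_rw [h]
  have hk' : (k : ℂ) * Complex.I ≠ 0 := by simp [hk]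
  rw [integral_exp_mul_complex hk']
  have h2 : Complex.exp (k * Complex.I * (Real.pi : ℝ)) =
      Complex.exp (k * Complex.I * ((-Real.pi : ℝ) : ℂ)) := by
    rw [Complex.exp_eq_exp_iff_exists_int]
    exact ⟨k, by push_cast; ring⟩
  rw [h2]; simp

lemma integral_angleMeasure_monomial (t : ℝ) (m n : ℕ) :
    ∫ θ, polarPoint t θ ^ m * conj (polarPoint t θ) ^ n ∂angleMeasure =
      if m = n then (t : ℂ) ^ (2 * n) else 0 := by
  simp_rw [polarPoint_pow_mul_conj_pow]
  rw [integral_const_mul, integral_angleMeasure_exp]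
  by_cases h : m = n
  · subst h; simp [two_mul]
  · rw [if_neg h, if_neg, mul_zero]
    intro h'; apply h; omega

/-- The integral over a circle picks out a Taylor coefficient. -/
lemma integral_angleMeasure_tsum_mul_conj_pow {a : ℕ → ℂ} {t : ℝ} (ht : 0 ≤ t)
    (ha : Summable fun k => ‖a k‖ * t ^ k) (n : ℕ) :
    ∫ θ, (∑' k, a k * polarPoint t θ ^ k) * conj (polarPoint t θ) ^ n ∂angleMeasure =
      a n * (t : ℂ) ^ (2 * n) := by
  have h1 : ∀ θ, (∑' k, a k * polarPoint t θ ^ k) * conj (polarPoint t θ) ^ n =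
      ∑' k, a k * (polarPoint t θ ^ k * conj (polarPoint t θ) ^ n) := by
    intro θ
    rw [← tsum_mul_right]
    exact tsum_congr fun k => by ring
  simp_rw [h1]
  have hb : ∀ k θ, ‖a k * (polarPoint t θ ^ k * conj (polarPoint t θ) ^ n)‖ =
      ‖a k‖ * t ^ k * t ^ n := by
    intro k θ
    simp [abs_of_nonneg ht, mul_assoc]
  have hi : ∀ k, Integrable
      (fun θ => a k * (polarPoint t θ ^ k * conj (polarPoint t θ) ^ n)) angleMeasure := by
    intro k
    refine Integrable.of_bound (C := ‖a k‖ * t ^ k * t ^ n) ?_ ?_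
    · have : Continuous fun θ => a k * (polarPoint t θ ^ k * conj (polarPoint t θ) ^ n) := by
        fun_prop
      exact this.aestronglyMeasurable
    · exact Eventually.of_forall fun θ => (hb k θ).le
  rw [← integral_tsum_of_summable_integral_norm hi]
  · simp_rw [integral_const_mul, integral_angleMeasure_monomial]
    rw [tsum_eq_single n]
    · simp
    · intro k hk; simp [hk]
  · simp_rw [hb]
    simpa using ha.mul_right (t ^ n)

/-- Parseval's identity on a circle. -/
lemma integral_angleMeasure_norm_sq_tsum {a : ℕ → ℂ} {t : ℝ} (ht : 0 ≤ t)
    (ha : Summable fun k => ‖a k‖ * t ^ k) :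
    ∫ θ, ‖∑' k, a k * polarPoint t θ ^ k‖ ^ 2 ∂angleMeasure =
      ∑' k, ‖a k‖ ^ 2 * t ^ (2 * k) := by
  set F : ℝ → ℂ := fun θ => ∑' k, a k * polarPoint t θ ^ k with hF
  have hb : ∀ k θ, ‖a k * polarPoint t θ ^ k‖ = ‖a k‖ * t ^ k := by
    intro k θ; simp [abs_of_nonneg ht]
  have hcont : Continuous F :=
    continuous_tsum (fun k => by fun_prop) ha (fun k θ => (hb k θ).le)
  have hFb : ∀ θ, ‖F θ‖ ≤ ∑' k, ‖a k‖ * t ^ k := by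
    intro θ
    have := norm_tsum_le_tsum_norm (f := fun k => a k * polarPoint t θ ^ k)
      (by simpa only [hb] using ha)
    simpa only [hb] using this
  -- Only the conjugated factor is expanded. Each term is then a Taylor coefficient integral of the
  -- intact `F`, and no double series appears.
  have key : ∫ θ, F θ * conj (F θ) ∂angleMeasure =
      ∑' k, ((‖a k‖ ^ 2 * t ^ (2 * k) : ℝ) : ℂ) := by
    have h1 : ∀ θ, F θ * conj (F θ) =
        ∑' n, conj (a n) * (F θ * conj (polarPoint t θ) ^ n) := by
      intro θ
      conv_lhs => rw [show conj (F θ) = ∑' n, conj (a n * polarPoint t θ ^ n) from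
        (Complex.conjCLE.map_tsum (f := fun k => a k * polarPoint t θ ^ k))]
      rw [← tsum_mul_left]
      exact tsum_congr fun k => by simp; ring
    simp_rw [h1]
    have hnb : ∀ n θ, ‖conj (a n) * (F θ * conj (polarPoint t θ) ^ n)‖ ≤
        (∑' k, ‖a k‖ * t ^ k) * (‖a n‖ * t ^ n) := by
      intro n θ
      have : ‖conj (a n) * (F θ * conj (polarPoint t θ) ^ n)‖ = ‖F θ‖ * (‖a n‖ * t ^ n) := by
        simp [abs_of_nonneg ht]; ring
      rw [this]
      exact mul_le_mul_of_nonneg_right (hFb θ) (by positivity)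
    have hi : ∀ n, Integrable
        (fun θ => conj (a n) * (F θ * conj (polarPoint t θ) ^ n)) angleMeasure := by
      intro n
      refine Integrable.of_bound (C := (∑' k, ‖a k‖ * t ^ k) * (‖a n‖ * t ^ n)) ?_
        (Eventually.of_forall (hnb n))
      have : Continuous fun θ => conj (a n) * (F θ * conj (polarPoint t θ) ^ n) := by
        fun_prop
      exact this.aestronglyMeasurable
    rw [← integral_tsum_of_summable_integral_norm hi]
    · refine tsum_congr fun n => ?_
      rw [integral_const_mul, integral_angleMeasure_tsum_mul_conj_pow ht ha, ← mul_assoc,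
        Complex.conj_mul']
      push_cast; ring
    · refine Summable.of_nonneg_of_le (fun n => integral_nonneg fun θ => norm_nonneg _)
        (fun n => ?_) (ha.mul_left (∑' k, ‖a k‖ * t ^ k))
      calc _ ≤ ∫ θ, (∑' k, ‖a k‖ * t ^ k) * (‖a n‖ * t ^ n) ∂angleMeasure :=
            integral_mono (hi n).norm (integrable_const _) (hnb n)
        _ = _ := by simp
  have h2 : ∀ θ, F θ * conj (F θ) = ((‖F θ‖ ^ 2 : ℝ) : ℂ) := by
    intro θ; rw [Complex.mul_conj']; push_cast; rfl
  simp_rw [h2] at key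
  rw [integral_complex_ofReal, ← Complex.ofReal_tsum] at key
  exact_mod_cast key

/-! ### The measure `ω dA` in polar coordinates -/

/-- The measure `ω dA` on the disk. -/
def weightMeasure (ω : ℂ → ℝ) : Measure ℂ :=
  diskArea.withDensity fun z => ENNReal.ofReal (ω z)

/-- The radial part `2 t ω(t) dt` on `(0, 1)` of the measure `ω dA`. -/
def radialMeasure (ω : ℂ → ℝ) : Measure ℝ :=
  (volume.restrict (Ioo (0 : ℝ) 1)).withDensity fun t => ENNReal.ofReal (2 * t * ω t)

lemma polarCoord_symm_eq_polarPoint (p : ℝ × ℝ) :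
    Complex.polarCoord.symm p = polarPoint p.1 p.2 := by
  rw [Complex.polarCoord_symm_apply, polarPoint, Complex.exp_mul_I]
  simp

lemma lintegral_polarPoint (f : ℂ → ℝ≥0∞) :
    ∫⁻ p in Ioi (0 : ℝ) ×ˢ Ioo (-Real.pi) Real.pi, ENNReal.ofReal p.1 * f (polarPoint p.1 p.2) =
      ∫⁻ z, f z := by
  rw [← Complex.lintegral_comp_polarCoord_symm]
  simp_rw [polarCoord_symm_eq_polarPoint]
  rfl

lemma setLIntegral_ball_polarPoint (f : ℂ → ℝ≥0∞) :
    ∫⁻ z in ball (0 : ℂ) 1, f z =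
    ∫⁻ p in Ioo (0 : ℝ) 1 ×ˢ Ioo (-Real.pi) Real.pi,
      ENNReal.ofReal p.1 * f (polarPoint p.1 p.2) := by
  rw [← lintegral_indicator measurableSet_ball, ← lintegral_polarPoint,
    ← lintegral_indicator (measurableSet_Ioi.prod measurableSet_Ioo),
    ← lintegral_indicator (measurableSet_Ioo.prod measurableSet_Ioo)]
  congr 1
  ext p
  by_cases hp : 0 < p.1
  · by_cases h1 : p.1 < 1 <;> by_cases h2 : p.2 ∈ Ioo (-Real.pi) Real.pi <;>
      simp [indicator, hp, h1, h2, abs_of_pos hp, mem_prod]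
  · simp [indicator, hp, mem_prod]

namespace IsRadialWeight

variable {ω : ℂ → ℝ}

lemma aemeasurable_disk (hω : IsRadialWeight ω) :
    AEMeasurable ω (volume.restrict (ball (0 : ℂ) 1)) := by
  have h := hω.integrable.aestronglyMeasurable.aemeasurable
  rw [diskArea] at h
  refine h.mono_ac ?_
  exact Measure.absolutelyContinuous_smul (by simp)

lemma eq_polarPoint (hω : IsRadialWeight ω) {t : ℝ} (ht : t ∈ Ioo (0 : ℝ) 1) (θ : ℝ) :
    ω (polarPoint t θ) = ω t := by
  rw [hω.radial _ (by simpa [abs_of_pos ht.1] using ht.2), norm_polarPoint, abs_of_pos ht.1]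

/-- Measurability of `ω` is known only almost everywhere on the disk, and the segment `(0,1)` is
itself a null set. By Fubini some ray meets the exceptional null set in a null set of radii, and
radiality transports a measurable representative from that ray to the segment. -/
lemma aemeasurable_radial (hω : IsRadialWeight ω) :
    AEMeasurable (fun t : ℝ => ω t) (volume.restrict (Ioo (0 : ℝ) 1)) := by
  obtain ⟨g, hg, hgω⟩ := hω.aemeasurable_disk
  set N := toMeasurable (volume.restrict (ball (0 : ℂ) 1)) {z | ω z ≠ g z} with hN
  have hNm : MeasurableSet N := measurableSet_toMeasurable _ _
  have hN0 : volume.restrict (ball (0 : ℂ) 1) N = 0 := by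
    rw [hN, measure_toMeasurable]; exact hgω
  have h1 := setLIntegral_ball_polarPoint (N.indicator 1)
  rw [lintegral_indicator_one hNm, hN0] at h1
  have hpp : Measurable fun p : ℝ × ℝ => polarPoint p.1 p.2 := by fun_prop
  have hmeas : Measurable fun p : ℝ × ℝ =>
      ENNReal.ofReal p.1 * N.indicator (1 : ℂ → ℝ≥0∞) (polarPoint p.1 p.2) := by
    refine Measurable.mul (by fun_prop) ?_
    exact (measurable_one.indicator hNm).comp hpp
  have h2 := (lintegral_eq_zero_iff hmeas).1 h1.symm
  have h3 : ∀ᵐ p ∂((volume.restrict (Ioo (0 : ℝ) 1)).prod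
      (volume.restrict (Ioo (-Real.pi) Real.pi))), polarPoint p.1 p.2 ∉ N := by
    rw [Measure.prod_restrict, ← Measure.volume_eq_prod]
    filter_upwards [h2, ae_restrict_mem (measurableSet_Ioo.prod measurableSet_Ioo)] with p hp hp'
    intro hmem
    have : 0 < p.1 := hp'.1.1
    simp [hmem] at hp
    linarith
  have h4 := (Measure.ae_ae_comm (p := fun t θ => polarPoint t θ ∉ N)
    (hpp hNm).compl).1 (Measure.ae_ae_of_ae_prod h3)
  have hne : NeBot (ae (volume.restrict (Ioo (-Real.pi) Real.pi))) := by
    rw [ae_neBot]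
    simp [Measure.restrict_eq_zero, Real.pi_pos]
  obtain ⟨θ, hθ⟩ := h4.exists
  refine ⟨fun t => g (polarPoint t θ), hg.comp (by fun_prop), ?_⟩
  filter_upwards [hθ, ae_restrict_mem measurableSet_Ioo] with t ht ht'
  by_contra hcon
  apply ht
  apply subset_toMeasurable
  simpa [hω.eq_polarPoint ht' θ] using hcon

lemma nonneg_radial (hω : IsRadialWeight ω) {t : ℝ} (ht : t ∈ Ioo (0 : ℝ) 1) : 0 ≤ ω t :=
  hω.nonneg _ (by simpa [abs_of_pos ht.1] using ht.2)

/-- The measure `ω dA` in polar coordinates. -/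
theorem weightMeasure_eq_map (hω : IsRadialWeight ω) :
    weightMeasure ω =
      ((radialMeasure ω).prod angleMeasure).map fun p => polarPoint p.1 p.2 := by
  have hpp : Measurable fun p : ℝ × ℝ => polarPoint p.1 p.2 := by fun_prop
  have hsf : SFinite (radialMeasure ω) := by unfold radialMeasure; infer_instance
  refine Measure.ext_of_lintegral _ fun F hF => ?_
  have hFp : Measurable fun p : ℝ × ℝ => F (polarPoint p.1 p.2) := hF.comp hpp
  have hm : AEMeasurable (fun t : ℝ => ENNReal.ofReal (2 * t * ω t))
      (volume.restrict (Ioo (0 : ℝ) 1)) :=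
    ((measurable_const.mul measurable_id).aemeasurable.mul hω.aemeasurable_radial).ennreal_ofReal
  rw [lintegral_map hF hpp, lintegral_prod _ hFp.aemeasurable, radialMeasure,
    lintegral_withDensity_eq_lintegral_mul₀ hm hFp.lintegral_prod_right'.aemeasurable,
    weightMeasure, lintegral_withDensity_eq_lintegral_mul₀
      hω.integrable.aestronglyMeasurable.aemeasurable.ennreal_ofReal hF.aemeasurable,
    diskArea, lintegral_smul_measure, setLIntegral_ball_polarPoint]
  have h1 : ∫⁻ p in Ioo (0 : ℝ) 1 ×ˢ Ioo (-Real.pi) Real.pi, ENNReal.ofReal p.1 *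
      ((fun a => ENNReal.ofReal (ω a)) * F) (polarPoint p.1 p.2) =
      ∫⁻ p in Ioo (0 : ℝ) 1 ×ˢ Ioo (-Real.pi) Real.pi, ENNReal.ofReal p.1 *
      (ENNReal.ofReal (ω p.1) * F (polarPoint p.1 p.2)) := by
    refine setLIntegral_congr_fun (measurableSet_Ioo.prod measurableSet_Ioo) fun p hp => ?_
    simp only [Pi.mul_apply]
    rw [hω.eq_polarPoint hp.1]
  rw [h1, Measure.volume_eq_prod, ← Measure.prod_restrict, lintegral_prod]
  · simp only [angleMeasure, Pi.mul_apply, lintegral_smul_measure, smul_eq_mul]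
    rw [← lintegral_const_mul']
    swap
    · simp [Real.pi_pos]
    refine setLIntegral_congr_fun measurableSet_Ioo fun t ht => ?_
    have ht0 : 0 ≤ t := ht.1.le
    have hpm : Measurable fun θ => F (polarPoint t θ) := hF.comp (by fun_prop)
    rw [lintegral_const_mul _ (by fun_prop), lintegral_const_mul _ (by fun_prop),
      ENNReal.ofReal_mul (by positivity), ENNReal.ofReal_mul (by positivity),
      ENNReal.ofReal_mul (p := 2) (by positivity), ENNReal.mul_inv (by simp) (by simp)]
    -- The 2 in the radial density `2tω(t)` cancels the 2 in the normalization `1/(2π)` of the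
    -- angle, leaving `π⁻¹ t dt dθ`.
    rw [show ENNReal.ofReal 2 * ENNReal.ofReal t * ENNReal.ofReal (ω t) *
      ((ENNReal.ofReal 2)⁻¹ * (ENNReal.ofReal Real.pi)⁻¹ *
        ∫⁻ θ in Ioo (-Real.pi) Real.pi, F (polarPoint t θ)) =
      (ENNReal.ofReal 2 * (ENNReal.ofReal 2)⁻¹) * ((ENNReal.ofReal Real.pi)⁻¹ *
        (ENNReal.ofReal t * (ENNReal.ofReal (ω t) *
        ∫⁻ θ in Ioo (-Real.pi) Real.pi, F (polarPoint t θ)))) by ring,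
      ENNReal.mul_inv_cancel (by simp) (by simp), one_mul]
  · refine AEMeasurable.mul (by fun_prop) (AEMeasurable.mul ?_ hFp.aemeasurable)
    exact hω.aemeasurable_radial.ennreal_ofReal.comp_quasiMeasurePreserving
      Measure.quasiMeasurePreserving_fst

lemma isFiniteMeasure_weightMeasure (hω : IsRadialWeight ω) :
    IsFiniteMeasure (weightMeasure ω) := by
  unfold weightMeasure
  exact isFiniteMeasure_withDensity_ofReal hω.integrable.2

lemma isFiniteMeasure_radialMeasure (hω : IsRadialWeight ω) :
    IsFiniteMeasure (radialMeasure ω) := by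
  have h := hω.isFiniteMeasure_weightMeasure
  have hpp : Measurable fun p : ℝ × ℝ => polarPoint p.1 p.2 := by fun_prop
  have hsf : SFinite (radialMeasure ω) := by unfold radialMeasure; infer_instance
  refine ⟨?_⟩
  have h2 : weightMeasure ω univ = radialMeasure ω univ := by
    rw [hω.weightMeasure_eq_map, Measure.map_apply hpp MeasurableSet.univ, preimage_univ,
      ← univ_prod_univ, Measure.prod_prod, measure_univ (μ := angleMeasure), mul_one]
  rw [← h2]
  exact measure_lt_top _ _

end IsRadialWeight

lemma weightMeasure_absolutelyContinuous (ω : ℂ → ℝ) :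
    weightMeasure ω ≪ volume.restrict (ball (0 : ℂ) 1) := by
  refine (withDensity_absolutelyContinuous _ _).trans ?_
  exact Measure.smul_absolutelyContinuous

lemma ae_weightMeasure_mem_ball (ω : ℂ → ℝ) :
    ∀ᵐ z ∂weightMeasure ω, z ∈ ball (0 : ℂ) 1 :=
  (weightMeasure_absolutelyContinuous ω).ae_le (ae_restrict_mem measurableSet_ball)

lemma ae_radialMeasure_mem (ω : ℂ → ℝ) : ∀ᵐ t ∂radialMeasure ω, t ∈ Ioo (0 : ℝ) 1 :=
  (withDensity_absolutelyContinuous _ _).ae_le (ae_restrict_mem measurableSet_Ioo)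

/-! ### Doubling measures on the line, and the transfer from the weight -/

/-- The tail function `r ↦ μ (r, ∞)` of a measure on the line. -/
def tail (μ : Measure ℝ) (r : ℝ) : ℝ := μ.real (Ioi r)

/-- The even moments of a measure on the line. -/
def moment (μ : Measure ℝ) (n : ℕ) : ℝ := ∫ t, t ^ (2 * n) ∂μ

/-- Diffuse finite measures on `(0, 1)` whose tail is positive and two-sided doubling at `1`. -/
structure IsDoublingMeasure (μ : Measure ℝ) : Prop where
  finite : IsFiniteMeasure μ
  singleton : ∀ t, μ {t} = 0
  ae_mem : ∀ᵐ t ∂μ, t ∈ Ioo (0 : ℝ) 1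
  tail_pos : ∀ r < 1, 0 < tail μ r
  upper : ∃ p : ℕ, ∀ r ∈ Ico (0 : ℝ) 1, tail μ r ≤ 2 ^ p * tail μ ((1 + r) / 2)
  lower : ∃ K : ℝ, 1 < K ∧ ∀ r ∈ Ico (0 : ℝ) 1, 2 * tail μ (1 - (1 - r) / K) ≤ tail μ r

section Transfer

variable {ω : ℂ → ℝ}

lemma radialMeasure_Ioi (ω : ℂ → ℝ) {r : ℝ} (hr : 0 ≤ r) :
    radialMeasure ω (Ioi r) = ∫⁻ t in Ioo r 1, ENNReal.ofReal (2 * t * ω t) := by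
  rw [radialMeasure, withDensity_apply _ measurableSet_Ioi,
    Measure.restrict_restrict measurableSet_Ioi]
  congr 2
  ext t
  simp only [mem_inter_iff, mem_Ioi, mem_Ioo]
  constructor
  · rintro ⟨h1, h2, h3⟩; exact ⟨h1, h3⟩
  · rintro ⟨h1, h2⟩; exact ⟨h1, by linarith, h2⟩

lemma IsRadialWeight.radialMeasure_Ioi_le (hω : IsRadialWeight ω) {r : ℝ} (hr : 0 ≤ r) :
    radialMeasure ω (Ioi r) ≤ 2 * weightTail ω r := by
  rw [radialMeasure_Ioi ω hr, weightTail, ← lintegral_const_mul' _ _ (by simp)]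
  refine setLIntegral_mono' measurableSet_Ioo fun t ht => ?_
  have h0 := hω.nonneg_radial (t := t) ⟨by linarith [ht.1], ht.2⟩
  rw [show (2 : ℝ≥0∞) = ENNReal.ofReal 2 by simp, ← ENNReal.ofReal_mul (by norm_num)]
  refine ENNReal.ofReal_le_ofReal ?_
  nlinarith [ht.2]

lemma IsRadialWeight.weightTail_le (hω : IsRadialWeight ω) {r : ℝ} (hr : 1 / 2 ≤ r) :
    weightTail ω r ≤ radialMeasure ω (Ioi r) := by
  rw [radialMeasure_Ioi ω (by linarith), weightTail]
  refine setLIntegral_mono' measurableSet_Ioo fun t ht => ?_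
  have h0 := hω.nonneg_radial (t := t) ⟨by linarith [ht.1], ht.2⟩
  refine ENNReal.ofReal_le_ofReal ?_
  nlinarith [ht.1]

lemma IsDoublingWeight.weightTail_iterate {ω : ℂ → ℝ} {K C : ℝ} (hK : 1 < K)
    (h : ∀ r ∈ Ico (0 : ℝ) 1,
      ENNReal.ofReal C * weightTail ω (1 - (1 - r) / K) ≤ weightTail ω r) (j : ℕ)
    {r : ℝ} (hr : r ∈ Ico (0 : ℝ) 1) :
    ENNReal.ofReal C ^ j * weightTail ω (1 - (1 - r) / K ^ j) ≤ weightTail ω r := by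
  induction j with
  | zero => simp
  | succ j ih =>
    have hKj : 1 ≤ K ^ j := one_le_pow₀ hK.le
    have h1 : 1 - (1 - r) / K ^ j ∈ Ico (0 : ℝ) 1 := by
      constructor
      · have : (1 - r) / K ^ j ≤ 1 := by
          rw [div_le_one (by positivity)]; linarith [hr.1]
        linarith
      · have : 0 < (1 - r) / K ^ j := div_pos (by linarith [hr.2]) (by positivity)
        linarith
    have h2 := h _ h1
    rw [show 1 - (1 - (1 - (1 - r) / K ^ j)) / K = 1 - (1 - r) / K ^ (j + 1) by
      rw [pow_succ]; field_simp; ring] at h2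
    calc _ = ENNReal.ofReal C ^ j *
        (ENNReal.ofReal C * weightTail ω (1 - (1 - r) / K ^ (j + 1))) := by ring
      _ ≤ ENNReal.ofReal C ^ j * weightTail ω (1 - (1 - r) / K ^ j) := by gcongr
      _ ≤ _ := ih

theorem IsDoublingWeight.isDoublingMeasure (hω : IsDoublingWeight ω) :
    IsDoublingMeasure (radialMeasure ω) := by
  have hR := hω.toIsRadialWeight
  have hfin := hR.isFiniteMeasure_radialMeasure
  obtain ⟨C, hC, hup⟩ := hω.upper
  obtain ⟨K, C', hK, hC', hlow⟩ := hω.lower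
  -- The density `2tω(t)` dominates `ω(t)` only for `t ≥ 1/2`. One application of upper doubling
  -- moves `r` to `(1+r)/2 ≥ 1/2`, which gives a comparison valid down to `r = 0`.
  have key : ∀ r ∈ Ico (0 : ℝ) 1,
      2 * weightTail ω r ≤ ENNReal.ofReal (2 * C) * radialMeasure ω (Ioi ((1 + r) / 2)) := by
    intro r hr
    rw [ENNReal.ofReal_mul (by norm_num), mul_assoc]
    refine mul_le_mul' (by simp) ((hup r hr).trans ?_)
    gcongr
    exact hR.weightTail_le (by linarith [hr.1])
  refine ⟨hfin, ?_, ae_radialMeasure_mem ω, ?_, ?_, ?_⟩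
  · intro t
    exact withDensity_absolutelyContinuous _ _ (measure_singleton t)
  · intro r hr
    have h1 : (1 + max r 0) / 2 < 1 := by
      have : max r 0 < 1 := max_lt hr one_pos
      linarith
    have h0 : 0 ≤ max r 0 := le_max_right _ _
    have hle : r ≤ (1 + max r 0) / 2 := by
      have := le_max_left r 0
      have : max r 0 < 1 := max_lt hr one_pos
      linarith
    have h2 := hR.tail_ne_zero ((1 + max r 0) / 2) ⟨by linarith, h1⟩
    have h3 := hR.weightTail_le (r := (1 + max r 0) / 2) (by linarith)
    refine ENNReal.toReal_pos (fun h => h2 ?_) (measure_ne_top _ _)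
    have h4 : radialMeasure ω (Ioi ((1 + max r 0) / 2)) = 0 :=
      measure_mono_null (Ioi_subset_Ioi hle) h
    simpa [h4] using h3
  · obtain ⟨p, hp⟩ := pow_unbounded_of_one_lt (2 * C) (one_lt_two (α := ℝ))
    refine ⟨p, fun r hr => ?_⟩
    have h := (hR.radialMeasure_Ioi_le hr.1).trans (key r hr)
    have h2 := ENNReal.toReal_mono (ENNReal.mul_ne_top ENNReal.ofReal_ne_top (measure_ne_top _ _)) h
    rw [ENNReal.toReal_mul, ENNReal.toReal_ofReal (by positivity)] at h2
    exact h2.trans (mul_le_mul_of_nonneg_right hp.le (by positivity))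
  -- Passing between `weightTail` and `tail` costs a factor `2C`, so the lower condition is iterated
  -- until its constant is at least `4C`, which leaves the required 2. The exponent `j + 1` keeps
  -- the new `K` above 1 even when `j = 0`.
  · obtain ⟨j, hj⟩ := pow_unbounded_of_one_lt (4 * C) hC'
    refine ⟨K ^ (j + 1), one_lt_pow₀ hK (by simp), fun r hr => ?_⟩
    have hKj : 1 ≤ K ^ (j + 1) := one_le_pow₀ hK.le
    have hr' : 0 ≤ 1 - (1 - r) / K ^ (j + 1) := by
      have : (1 - r) / K ^ (j + 1) ≤ 1 := by
        rw [div_le_one (by positivity)]; linarith [hr.1]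
      linarith
    have h : ENNReal.ofReal C' ^ (j + 1) * radialMeasure ω (Ioi (1 - (1 - r) / K ^ (j + 1))) ≤
        ENNReal.ofReal (2 * C) * radialMeasure ω (Ioi r) :=
      calc _ ≤ ENNReal.ofReal C' ^ (j + 1) *
            (2 * weightTail ω (1 - (1 - r) / K ^ (j + 1))) := by
            gcongr; exact hR.radialMeasure_Ioi_le hr'
        _ = 2 * (ENNReal.ofReal C' ^ (j + 1) * weightTail ω (1 - (1 - r) / K ^ (j + 1))) := by
            ring
        _ ≤ 2 * weightTail ω r := by
            gcongr; exact IsDoublingWeight.weightTail_iterate hK hlow (j + 1) hr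
        _ ≤ _ := key r hr
        _ ≤ _ := by gcongr; linarith [hr.2]
    have h2 := ENNReal.toReal_mono (ENNReal.mul_ne_top ENNReal.ofReal_ne_top (measure_ne_top _ _)) h
    rw [ENNReal.toReal_mul, ENNReal.toReal_mul, ENNReal.toReal_pow,
      ENNReal.toReal_ofReal (by positivity), ENNReal.toReal_ofReal (by positivity)] at h2
    change C' ^ (j + 1) * tail _ _ ≤ 2 * C * tail _ _ at h2
    have h3 : 4 * C ≤ C' ^ (j + 1) := hj.le.trans (pow_le_pow_right₀ hC'.le (by simp))
    have h4 : 0 ≤ tail (radialMeasure ω) (1 - (1 - r) / K ^ (j + 1)) := measureReal_nonneg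
    have h5 : 4 * C * tail (radialMeasure ω) (1 - (1 - r) / K ^ (j + 1)) ≤
        2 * C * tail (radialMeasure ω) r := (mul_le_mul_of_nonneg_right h3 h4).trans h2
    nlinarith

end Transfer

/-! ### Tails and moments of a doubling measure -/

lemma tail_nonneg (μ : Measure ℝ) (r : ℝ) : 0 ≤ tail μ r := measureReal_nonneg

namespace IsDoublingMeasure

variable {μ : Measure ℝ}

lemma tail_antitone (hμ : IsDoublingMeasure μ) : Antitone (tail μ) := by
  have := hμ.finite
  intro r s h
  exact measureReal_mono (Ioi_subset_Ioi h)

/-- Dominated convergence: the indicator of `(s,∞)` evaluated at `t` jumps in `s` only at `s = t`,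
and `μ` has no atoms. -/
lemma continuous_tail (hμ : IsDoublingMeasure μ) : Continuous (tail μ) := by
  have := hμ.finite
  have h : tail μ = fun r => ∫ t, (Ioi r).indicator (fun _ => (1 : ℝ)) t ∂μ := by
    ext r
    rw [integral_indicator_const _ measurableSet_Ioi]
    simp [tail]
  rw [h, continuous_iff_continuousAt]
  intro r
  refine continuousAt_of_dominated (bound := fun _ => 1) ?_ ?_ (integrable_const _) ?_
  · exact Eventually.of_forall fun s =>
      (measurable_const.indicator measurableSet_Ioi).aestronglyMeasurable
  · refine Eventually.of_forall fun s => Eventually.of_forall fun t => ?_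
    by_cases ht : t ∈ Ioi s <;> simp [ht]
  · have h2 : ∀ᵐ t ∂μ, t ≠ r := by
      rw [ae_iff]; simpa using hμ.singleton r
    filter_upwards [h2] with t ht
    rcases lt_or_gt_of_ne ht with ht | ht
    · refine (continuousAt_const (y := (0 : ℝ))).congr ?_
      filter_upwards [lt_mem_nhds ht] with s hs
      simp [indicator, not_lt.2 hs.le]
    · refine (continuousAt_const (y := (1 : ℝ))).congr ?_
      filter_upwards [gt_mem_nhds ht] with s hs
      simp [indicator, hs]

lemma integrable_of_bound (hμ : IsDoublingMeasure μ) {E : Type*} [NormedAddCommGroup E]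
    {f : ℝ → E} (hf : AEStronglyMeasurable f μ) (C : ℝ) (h : ∀ t ∈ Ioo (0 : ℝ) 1, ‖f t‖ ≤ C) :
    Integrable f μ := by
  have := hμ.finite
  exact Integrable.of_bound hf C (hμ.ae_mem.mono h)

lemma integrable_pow (hμ : IsDoublingMeasure μ) (n : ℕ) : Integrable (fun t => t ^ n) μ := by
  refine hμ.integrable_of_bound (by fun_prop) 1 fun t ht => ?_
  rw [norm_pow, Real.norm_of_nonneg ht.1.le]
  exact pow_le_one₀ ht.1.le ht.2.le

lemma pow_mul_tail_le_moment (hμ : IsDoublingMeasure μ) {r : ℝ} (hr : 0 ≤ r) (n : ℕ) :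
    r ^ (2 * n) * tail μ r ≤ moment μ n := by
  have := hμ.finite
  have h1 : r ^ (2 * n) * tail μ r =
      ∫ t, (Ioi r).indicator (fun _ => r ^ (2 * n)) t ∂μ := by
    rw [integral_indicator_const _ measurableSet_Ioi, smul_eq_mul, tail, mul_comm]
  rw [h1, moment]
  refine integral_mono_ae ?_ (hμ.integrable_pow _) ?_
  · exact (integrable_const _).indicator measurableSet_Ioi
  · filter_upwards [hμ.ae_mem] with t ht
    by_cases hrt : r < t
    · simp only [indicator, mem_Ioi, hrt, if_true]
      exact pow_le_pow_left₀ hr hrt.le _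
    · simp only [indicator, mem_Ioi, hrt, if_false]
      exact pow_nonneg ht.1.le _

lemma moment_pos (hμ : IsDoublingMeasure μ) (n : ℕ) : 0 < moment μ n := by
  have h := hμ.pow_mul_tail_le_moment (r := 1 / 2) (by norm_num) n
  have h2 := hμ.tail_pos (1 / 2) (by norm_num)
  have : 0 < (1 / 2 : ℝ) ^ (2 * n) * tail μ (1 / 2) := by positivity
  linarith

lemma moment_antitone (hμ : IsDoublingMeasure μ) : Antitone (moment μ) := by
  intro m n h
  refine integral_mono_ae (hμ.integrable_pow _) (hμ.integrable_pow _) ?_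
  filter_upwards [hμ.ae_mem] with t ht
  exact pow_le_pow_of_le_one ht.1.le ht.2.le (by omega)

/-- Moments decay more slowly than any geometric sequence: `m_n ≥ s^n T(√s)` for every `s < 1`.
Taking `s` between `r` and 1 leaves a convergent series in `r/s`. -/
lemma summable_pow_div_moment (hμ : IsDoublingMeasure μ) (k : ℕ) {r : ℝ} (hr : r ∈ Ico (0 : ℝ) 1) :
    Summable fun n : ℕ => (n : ℝ) ^ k / moment μ n * r ^ n := by
  obtain ⟨s, hs1, hs2⟩ := exists_between hr.2
  have hs0 : 0 < s := hr.1.trans_lt hs1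
  set ρ := √s with hρ
  have hρ0 : 0 < ρ := Real.sqrt_pos.2 hs0
  have hρ2 : ρ ^ 2 = s := Real.sq_sqrt hs0.le
  have hρ1 : ρ < 1 := by
    rw [hρ, Real.sqrt_lt' one_pos]; simpa using hs2
  have hT := hμ.tail_pos ρ hρ1
  have hq : ‖r / s‖ < 1 := by
    rw [Real.norm_of_nonneg (div_nonneg hr.1 hs0.le), div_lt_one hs0]; exact hs1
  refine Summable.of_nonneg_of_le (fun n => ?_) (fun n => ?_)
    ((summable_pow_mul_geometric_of_norm_lt_one k hq).mul_left (1 / tail μ ρ))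
  · have := hμ.moment_pos n
    have := hr.1
    positivity
  · have h1 := hμ.pow_mul_tail_le_moment hρ0.le n
    rw [pow_mul, hρ2] at h1
    have h2 : (n : ℝ) ^ k / moment μ n ≤ n ^ k / (s ^ n * tail μ ρ) := by
      gcongr
    have h3 := mul_le_mul_of_nonneg_right h2 (pow_nonneg hr.1 n)
    refine h3.trans (le_of_eq ?_)
    rw [div_pow]; field_simp

lemma tail_le_two_pow_mul {p : ℕ}
    (hp : ∀ r ∈ Ico (0 : ℝ) 1, tail μ r ≤ 2 ^ p * tail μ ((1 + r) / 2)) {r : ℝ}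
    (hr : r ∈ Ico (0 : ℝ) 1) (k : ℕ) :
    tail μ r ≤ (2 ^ k) ^ p * tail μ (1 - (1 - r) / 2 ^ k) := by
  induction k with
  | zero => simp
  | succ k ih =>
    have h2k : (1 : ℝ) ≤ 2 ^ k := one_le_pow₀ (by norm_num)
    have h1 : 1 - (1 - r) / 2 ^ k ∈ Ico (0 : ℝ) 1 := by
      constructor
      · have : (1 - r) / 2 ^ k ≤ 1 := by
          rw [div_le_one (by positivity)]; linarith [hr.1]
        linarith
      · have : 0 < (1 - r) / 2 ^ k := div_pos (by linarith [hr.2]) (by positivity)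
        linarith
    have h2 := hp _ h1
    rw [show (1 + (1 - (1 - r) / 2 ^ k)) / 2 = 1 - (1 - r) / 2 ^ (k + 1) by
      rw [pow_succ]; field_simp; ring] at h2
    calc tail μ r ≤ (2 ^ k) ^ p * tail μ (1 - (1 - r) / 2 ^ k) := ih
      _ ≤ (2 ^ k) ^ p * (2 ^ p * tail μ (1 - (1 - r) / 2 ^ (k + 1))) := by gcongr
      _ = _ := by rw [pow_succ (2 : ℝ) k, mul_pow]; ring

/-- Polynomial comparison of the tail with the moments. -/
lemma tail_le_moment (hμ : IsDoublingMeasure μ) {p : ℕ}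
    (hp : ∀ r ∈ Ico (0 : ℝ) 1, tail μ r ≤ 2 ^ p * tail μ ((1 + r) / 2)) {r : ℝ}
    (hr : r ∈ Ico (0 : ℝ) 1) (n : ℕ) :
    tail μ r ≤ 2 * (2 + 8 * (n * (1 - r))) ^ p * moment μ n := by
  have hr1 : 0 ≤ 1 - r := by linarith [hr.2]
  have hx : 1 ≤ 1 + 4 * (n * (1 - r)) := by
    have : 0 ≤ (n : ℝ) * (1 - r) := by positivity
    linarith
  -- The number of doublings is chosen so that `s` satisfies `n(1-s) ≤ 1/4`. Bernoulli then gives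
  -- `s^(2n) ≥ 1/2`, while `2^(k+1)` stays below `2 + 8n(1-r)`, the base of the polynomial factor.
  obtain ⟨k, hk1, hk2⟩ := exists_nat_pow_near hx (one_lt_two (α := ℝ))
  have h2k : (1 : ℝ) ≤ 2 ^ (k + 1) := one_le_pow₀ (by norm_num)
  set s := 1 - (1 - r) / 2 ^ (k + 1) with hs
  have hd : (1 - r) / 2 ^ (k + 1) ≤ 1 := by
    rw [div_le_one (by positivity)]; linarith [hr.1]
  have hs0 : 0 ≤ s := by linarith
  have hnx : n * ((1 - r) / 2 ^ (k + 1)) ≤ 1 / 4 := by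
    rw [← mul_div_assoc, div_le_iff₀ (by positivity)]
    linarith
  have h1 : (1 / 2 : ℝ) ≤ s ^ (2 * n) := by
    have := one_add_mul_le_pow (a := -((1 - r) / 2 ^ (k + 1))) (by linarith) (2 * n)
    rw [← sub_eq_add_neg, ← hs] at this
    push_cast at this
    nlinarith
  have h2 := hμ.pow_mul_tail_le_moment hs0 n
  have h3 := tail_le_two_pow_mul hp hr (k + 1)
  have h4 : tail μ s ≤ 2 * moment μ n := by
    have := mul_le_mul_of_nonneg_right h1 (tail_nonneg μ s)
    linarith
  have h5 : ((2 : ℝ) ^ (k + 1)) ^ p ≤ (2 + 8 * (n * (1 - r))) ^ p := by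
    refine pow_le_pow_left₀ (by positivity) ?_ p
    rw [pow_succ]; linarith
  have hm := hμ.moment_pos n
  calc tail μ r ≤ (2 ^ (k + 1)) ^ p * tail μ s := h3
    _ ≤ (2 + 8 * (n * (1 - r))) ^ p * (2 * moment μ n) :=
        mul_le_mul h5 h4 (tail_nonneg _ _) (by positivity)
    _ = _ := by ring

/-- The layer cake formula for the moments. -/
lemma ofReal_moment_eq (hμ : IsDoublingMeasure μ) (n : ℕ) :
    ENNReal.ofReal (moment μ (n + 1)) =
      ∫⁻ s in Ioo (0 : ℝ) 1,
        ENNReal.ofReal (tail μ s * ((2 * n + 2) * s ^ (2 * n + 1))) := by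
  have := hμ.finite
  have h1 := lintegral_comp_eq_lintegral_meas_lt_mul (f := fun t : ℝ => t)
    (g := fun s => (2 * n + 2) * s ^ (2 * n + 1)) μ
    (hμ.ae_mem.mono fun t ht => ht.1.le) aemeasurable_id'
    (fun t _ => (by fun_prop : Continuous fun s : ℝ => (2 * n + 2) * s ^ (2 * n + 1)
      ).intervalIntegrable _ _)
    ((ae_restrict_mem measurableSet_Ioi).mono fun t (ht : 0 < t) => by positivity)
  have h2 : ∀ t : ℝ, ∫ s in (0 : ℝ)..t, ((2 * n + 2) * s ^ (2 * n + 1) : ℝ) =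
      t ^ (2 * (n + 1)) := by
    intro t
    rw [intervalIntegral.integral_const_mul, integral_pow]
    have : (2 * (n : ℝ) + 1 + 1) ≠ 0 := by positivity
    push_cast
    field_simp
    rw [show 2 * (n + 1) = 2 * n + 1 + 1 by ring, zero_pow (by simp), sub_zero]
    ring
  simp_rw [h2] at h1
  rw [moment, ofReal_integral_eq_lintegral_ofReal (hμ.integrable_pow _)
    (hμ.ae_mem.mono fun t ht => pow_nonneg ht.1.le _), h1]
  have h3 : ∫⁻ t in Ioi (0 : ℝ), μ {a | t < a} *
      ENNReal.ofReal ((2 * n + 2) * t ^ (2 * n + 1)) =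
      ∫⁻ t in Ioi (0 : ℝ), ENNReal.ofReal (tail μ t * ((2 * n + 2) * t ^ (2 * n + 1))) := by
    refine lintegral_congr fun t => ?_
    rw [ENNReal.ofReal_mul (tail_nonneg _ _), tail, ofReal_measureReal]
    rfl
  rw [h3, ← Ioo_union_Ici_eq_Ioi (zero_lt_one (α := ℝ)),
    lintegral_union measurableSet_Ici (by
      rw [Set.disjoint_left]; intro a ha hb; exact absurd ha.2 (not_lt.2 hb))]
  -- There is no mass beyond 1, so the layer cake integral stops there.
  have h4 : ∫⁻ t in Ici (1 : ℝ), ENNReal.ofReal (tail μ t * ((2 * n + 2) * t ^ (2 * n + 1))) =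
      0 := by
    rw [← lintegral_zero (μ := volume.restrict (Ici (1 : ℝ)))]
    refine setLIntegral_congr_fun measurableSet_Ici fun t ht => ?_
    have h5 : tail μ t = 0 := by
      rw [tail, measureReal_eq_zero_iff]
      refine measure_mono_null ?_ (ae_iff.1 hμ.ae_mem)
      intro a ha hb
      exact absurd hb.2 (not_lt.2 ((mem_Ici.1 ht).trans (mem_Ioi.1 ha).le))
    simp [h5]
  rw [h4, add_zero]

end IsDoublingMeasure

/-- One term of the exponential series at `y + 2/c` dominates the polynomial. The lemma absorbs the
polynomial losses from `tail_le_moment`. -/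
lemma exists_pow_mul_exp_neg_le (c : ℝ) (hc : 0 < c) (q : ℕ) :
    ∃ A : ℝ, 0 < A ∧ ∀ y : ℝ, 0 ≤ y → (2 + c * y) ^ q * Real.exp (-y) ≤ A := by
  refine ⟨c ^ q * q.factorial * Real.exp (2 / c), by positivity, fun y hy => ?_⟩
  have h1 := Real.pow_div_factorial_le_exp (x := y + 2 / c) (by positivity) q
  rw [div_le_iff₀ (by positivity), Real.exp_add] at h1
  have h2 : (2 + c * y) ^ q = c ^ q * (y + 2 / c) ^ q := by
    rw [← mul_pow]; congr 1; field_simp; ring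
  rw [h2]
  calc c ^ q * (y + 2 / c) ^ q * Real.exp (-y)
      ≤ c ^ q * (Real.exp y * Real.exp (2 / c) * q.factorial) * Real.exp (-y) := by gcongr
    _ = c ^ q * q.factorial * Real.exp (2 / c) * (Real.exp y * Real.exp (-y)) := by ring
    _ = _ := by rw [← Real.exp_add]; simp

lemma pow_le_exp_neg_mul {r : ℝ} (hr : 0 ≤ r) (n : ℕ) :
    r ^ n ≤ Real.exp (-(n * (1 - r))) := by
  have h : r ≤ Real.exp (-(1 - r)) := by
    have := Real.add_one_le_exp (-(1 - r)); linarith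
  calc r ^ n ≤ Real.exp (-(1 - r)) ^ n := pow_le_pow_left₀ hr h n
    _ = _ := by rw [← Real.exp_nat_mul]; congr 1; ring

/-- Each of the `n` terms of `∑_{i<n} u^i` is at least `u^n`, and the sum times `1 - u` equals `1 -
u^n ≤ 1`. -/
lemma nat_mul_pow_mul_one_sub_le {u : ℝ} (hu : u ∈ Icc (0 : ℝ) 1) (n : ℕ) :
    n * u ^ n * (1 - u) ≤ 1 := by
  have h1 := mul_neg_geom_sum u n
  have h2 : n * u ^ n ≤ ∑ i ∈ Finset.range n, u ^ i := by
    have : ∑ i ∈ Finset.range n, u ^ n ≤ ∑ i ∈ Finset.range n, u ^ i :=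
      Finset.sum_le_sum fun i hi => pow_le_pow_of_le_one hu.1 hu.2 (Finset.mem_range.1 hi).le
    simpa using this
  have h3 : 0 ≤ u ^ n := pow_nonneg hu.1 n
  nlinarith [mul_le_mul_of_nonneg_left h2 (sub_nonneg.2 hu.2)]

namespace IsDoublingMeasure

variable {μ : Measure ℝ}

/-- The moments are doubling. -/
lemma exists_moment_le (hμ : IsDoublingMeasure μ) :
    ∃ C : ℝ, 0 < C ∧ ∀ m n : ℕ, n ≤ 2 * m + 1 → moment μ m ≤ C * moment μ n := by
  obtain ⟨p, hp⟩ := hμ.upper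
  obtain ⟨A, hA, hAb⟩ := exists_pow_mul_exp_neg_le 24 (by norm_num) p
  -- In the layer cake integrand `s^(2m+1)` is split as `s^(m+1) · s^m`. The first factor absorbs
  -- the polynomial growth of `tail/moment`, since `n ≤ 3(m+1)`, and the second integrates to
  -- `1/(m+1)`. The layer cake formula starts at index 1, so `m = 0` is treated separately below.
  have main : ∀ m n : ℕ, n ≤ 2 * (m + 1) + 1 →
      moment μ (m + 1) ≤ 4 * A * moment μ n := by
    intro m n hmn
    have hmn' : (n : ℝ) ≤ 3 * (m + 1) := by
      have : n ≤ 3 * (m + 1) := by omega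
      exact_mod_cast this
    have hn := hμ.moment_pos n
    have h1 : ENNReal.ofReal (moment μ (m + 1)) ≤
        ∫⁻ s in Ioo (0 : ℝ) 1, ENNReal.ofReal (4 * A * moment μ n * ((m + 1) * s ^ m)) := by
      rw [hμ.ofReal_moment_eq]
      refine setLIntegral_mono' measurableSet_Ioo fun s hs => ENNReal.ofReal_le_ofReal ?_
      have hs0 := hs.1
      have hs1 : 0 ≤ 1 - s := by linarith [hs.2]
      have h2 := hμ.tail_le_moment hp ⟨hs.1.le, hs.2⟩ n
      have h3 := pow_le_exp_neg_mul hs.1.le (m + 1)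
      have h4 := hAb (((m + 1 : ℕ) : ℝ) * (1 - s)) (by positivity)
      have h5 : (2 + 8 * (n * (1 - s))) ^ p ≤ (2 + 24 * (((m + 1 : ℕ) : ℝ) * (1 - s))) ^ p := by
        refine pow_le_pow_left₀ (by positivity) ?_ p
        push_cast
        nlinarith
      have h6 : (2 + 8 * (n * (1 - s))) ^ p * s ^ (m + 1) ≤ A :=
        (mul_le_mul h5 h3 (by positivity) (by positivity)).trans h4
      calc tail μ s * ((2 * m + 2) * s ^ (2 * m + 1))
          ≤ 2 * (2 + 8 * (n * (1 - s))) ^ p * moment μ n * ((2 * m + 2) * s ^ (2 * m + 1)) := by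
            gcongr
        _ = ((2 + 8 * (n * (1 - s))) ^ p * s ^ (m + 1)) *
              (4 * moment μ n * ((m + 1) * s ^ m)) := by
            rw [show 2 * m + 1 = (m + 1) + m by ring, pow_add]; ring
        _ ≤ A * (4 * moment μ n * ((m + 1) * s ^ m)) := by gcongr
        _ = _ := by ring
    have h2 : ∫⁻ s in Ioo (0 : ℝ) 1, ENNReal.ofReal (4 * A * moment μ n * ((m + 1) * s ^ m)) =
        ENNReal.ofReal (4 * A * moment μ n) := by
      rw [← ofReal_integral_eq_lintegral_ofReal]
      · rw [← integral_Ioc_eq_integral_Ioo,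
          ← intervalIntegral.integral_of_le zero_le_one, intervalIntegral.integral_const_mul,
          intervalIntegral.integral_const_mul, integral_pow]
        congr 1
        have : ((m : ℝ) + 1) ≠ 0 := by positivity
        field_simp
        simp
      · exact (by fun_prop : Continuous fun s : ℝ => 4 * A * moment μ n * ((m + 1) * s ^ m)
          ).integrableOn_Icc.mono_set Ioo_subset_Icc_self
      · filter_upwards [ae_restrict_mem measurableSet_Ioo] with s hs
        have := hs.1
        simp only [Pi.zero_apply]
        positivity
    rw [h2] at h1
    exact (ENNReal.ofReal_le_ofReal_iff (by positivity)).1 h1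
  have h1p := hμ.moment_pos 1
  have h0p := hμ.moment_pos 0
  refine ⟨4 * A + moment μ 0 / moment μ 1, by positivity, fun m n hmn => ?_⟩
  have hn := hμ.moment_pos n
  rcases m with _ | m
  · have h2 : moment μ 1 ≤ moment μ n := hμ.moment_antitone (by omega)
    have h3 : moment μ 0 = moment μ 0 / moment μ 1 * moment μ 1 := by field_simp
    have h4 : moment μ 0 / moment μ 1 * moment μ 1 ≤ moment μ 0 / moment μ 1 * moment μ n := by
      gcongr
    have : 0 ≤ 4 * A * moment μ n := by positivity
    linarith
  · have h2 := main m n hmn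
    have : 0 ≤ moment μ 0 / moment μ 1 * moment μ n := by positivity
    linarith

/-- Half of the power `t^(2n)` is kept for the moment on the right, and the other half absorbs
`n(1-t²)` through `nat_mul_pow_mul_one_sub_le`. The absorbed half is the one rounded up, so that `n
≤ 2(n - n/2)`. -/
lemma nat_mul_moment_sub_le (hμ : IsDoublingMeasure μ) (n : ℕ) :
    n * (moment μ n - moment μ (n + 1)) ≤ 2 * moment μ (n / 2) := by
  simp only [moment]
  rw [← integral_sub (hμ.integrable_pow _) (hμ.integrable_pow _), ← integral_const_mul,
    ← integral_const_mul]
  refine integral_mono_ae (((hμ.integrable_pow _).sub (hμ.integrable_pow _)).const_mul _)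
    ((hμ.integrable_pow _).const_mul _) ?_
  filter_upwards [hμ.ae_mem] with t ht
  have ht2 : t ^ 2 ∈ Icc (0 : ℝ) 1 := ⟨by positivity, pow_le_one₀ ht.1.le ht.2.le⟩
  have h1 := nat_mul_pow_mul_one_sub_le ht2 (n - n / 2)
  have h2 : (n : ℝ) ≤ 2 * ((n - n / 2 : ℕ) : ℝ) := by
    have : n ≤ 2 * (n - n / 2) := by omega
    exact_mod_cast this
  have h3 : t ^ (2 * n) = (t ^ 2) ^ (n / 2) * (t ^ 2) ^ (n - n / 2) := by
    rw [← pow_add, ← pow_mul]; congr 2; omega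
  have h4 : 0 ≤ (t ^ 2) ^ (n / 2) := by positivity
  have h5 : 0 ≤ (t ^ 2) ^ (n - n / 2) * (1 - t ^ 2) :=
    mul_nonneg (by positivity) (by linarith [ht2.2])
  calc n * (t ^ (2 * n) - t ^ (2 * (n + 1)))
      = (t ^ 2) ^ (n / 2) * (n * ((t ^ 2) ^ (n - n / 2) * (1 - t ^ 2))) := by
        rw [show 2 * (n + 1) = 2 * n + 2 by ring, pow_add, h3]; ring
    _ ≤ (t ^ 2) ^ (n / 2) * (2 * ((n - n / 2 : ℕ) : ℝ) *
          ((t ^ 2) ^ (n - n / 2) * (1 - t ^ 2))) := by gcongr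
    _ = (t ^ 2) ^ (n / 2) * (2 * (((n - n / 2 : ℕ) : ℝ) *
          (t ^ 2) ^ (n - n / 2) * (1 - t ^ 2))) := by ring
    _ ≤ (t ^ 2) ^ (n / 2) * (2 * 1) := by gcongr
    _ = 2 * t ^ (2 * (n / 2)) := by rw [← pow_mul]; ring

/-- First differences of the coefficients of the derivative of the kernel. -/
lemma exists_abs_coeff_sub_le (hμ : IsDoublingMeasure μ) :
    ∃ C : ℝ, 0 < C ∧ ∀ n : ℕ,
      |(n + 1) / moment μ (n + 1) - n / moment μ n| ≤ C / moment μ n := by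
  obtain ⟨C, hC, hCb⟩ := hμ.exists_moment_le
  refine ⟨C + C * (2 * C), by positivity, fun n => ?_⟩
  have hn := hμ.moment_pos n
  have hn1 := hμ.moment_pos (n + 1)
  have h1 := hCb n (n + 1) (by omega)
  -- For odd `n` this uses `n = 2(n/2) + 1`, which is why the moment comparison allows indices up to
  -- `2m + 1`.
  have h2 := hCb (n / 2) n (by omega)
  have h3 := hμ.nat_mul_moment_sub_le n
  have h4 : moment μ (n + 1) ≤ moment μ n := hμ.moment_antitone (by omega)
  have h5 : (n + 1) / moment μ (n + 1) - n / moment μ n =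
      1 / moment μ (n + 1) +
        n * (moment μ n - moment μ (n + 1)) / (moment μ n * moment μ (n + 1)) := by
    field_simp; ring
  have h6 : 1 / moment μ (n + 1) ≤ C / moment μ n := by
    rw [div_le_div_iff₀ hn1 hn]; linarith
  have h7 : 0 ≤ n * (moment μ n - moment μ (n + 1)) :=
    mul_nonneg (Nat.cast_nonneg _) (by linarith)
  rw [h5, abs_of_nonneg (by positivity), add_div]
  refine add_le_add h6 ?_
  calc n * (moment μ n - moment μ (n + 1)) / (moment μ n * moment μ (n + 1))
      ≤ (2 * (C * moment μ n)) / (moment μ n * moment μ (n + 1)) :=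
        div_le_div_of_nonneg_right (by linarith) (by positivity)
    _ = 2 * C * (1 / moment μ (n + 1)) := by field_simp
    _ ≤ 2 * C * (C / moment μ n) := by gcongr
    _ = _ := by ring

/-! ### Sums and integrals behind the kernel estimate -/

/-- By `tail_le_moment`, `1/m_n` is at most `1/T(r)` times a polynomial in `n(1-r)`. One of the two
factors `r^n` absorbs the square of the polynomial, and the other sums to `1/(1-r)`. -/
lemma exists_tsum_inv_moment_sq_le (hμ : IsDoublingMeasure μ) :
    ∃ C : ℝ, 0 < C ∧ ∀ r ∈ Ico (0 : ℝ) 1,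
      (Summable fun n : ℕ => r ^ (2 * n) / moment μ n ^ 2) ∧
      ∑' n : ℕ, r ^ (2 * n) / moment μ n ^ 2 ≤ C / ((1 - r) * tail μ r ^ 2) := by
  obtain ⟨p, hp⟩ := hμ.upper
  obtain ⟨A, hA, hAb⟩ := exists_pow_mul_exp_neg_le 8 (by norm_num) (2 * p)
  refine ⟨4 * A, by positivity, fun r hr => ?_⟩
  have hr1 : 0 ≤ 1 - r := by linarith [hr.2]
  have hr0 := hr.1
  have hT := hμ.tail_pos r hr.2
  have hterm : ∀ n : ℕ, r ^ (2 * n) / moment μ n ^ 2 ≤ 4 * A / tail μ r ^ 2 * r ^ n := by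
    intro n
    have hn := hμ.moment_pos n
    have h1 := hμ.tail_le_moment hp hr n
    have h2 := pow_le_exp_neg_mul hr.1 n
    have h3 := hAb (n * (1 - r)) (by positivity)
    have h4 : (2 + 8 * (n * (1 - r))) ^ (2 * p) * r ^ n ≤ A :=
      (mul_le_mul_of_nonneg_left h2 (by positivity)).trans h3
    have h5 : tail μ r ^ 2 ≤ 4 * (2 + 8 * (n * (1 - r))) ^ (2 * p) * moment μ n ^ 2 := by
      calc tail μ r ^ 2 ≤ (2 * (2 + 8 * (n * (1 - r))) ^ p * moment μ n) ^ 2 := by gcongr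
        _ = _ := by rw [show 2 * p = p * 2 by ring, pow_mul]; ring
    rw [div_mul_eq_mul_div, div_le_div_iff₀ (by positivity) (by positivity)]
    calc r ^ (2 * n) * tail μ r ^ 2
        ≤ r ^ (2 * n) * (4 * (2 + 8 * (n * (1 - r))) ^ (2 * p) * moment μ n ^ 2) := by gcongr
      _ = 4 * ((2 + 8 * (n * (1 - r))) ^ (2 * p) * r ^ n) * r ^ n * moment μ n ^ 2 := by
          rw [two_mul n, pow_add]; ring
      _ ≤ 4 * A * r ^ n * moment μ n ^ 2 := by gcongr
  have hg := (summable_geometric_of_lt_one hr.1 hr.2).mul_left (4 * A / tail μ r ^ 2)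
  have hs : Summable fun n : ℕ => r ^ (2 * n) / moment μ n ^ 2 :=
    Summable.of_nonneg_of_le (fun n => by positivity) hterm hg
  refine ⟨hs, (hs.tsum_le_tsum hterm hg).trans (le_of_eq ?_)⟩
  rw [tsum_mul_left, tsum_geometric_of_lt_one hr.1 hr.2, div_mul_eq_div_div]
  field_simp

/-- Dyadic induction towards 1. On `(r, (1+r)/2]` the integrand is at most `2/((1-r)T((1+r)/2))` and
the mass at most `T(r)`, so upper doubling bounds the increment by `A/(1-r)` with `A = 2·2^p`. The
bound reproduces itself because `A/(1-r) + A/(1-r) = A/(1-(1+r)/2)`. -/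
lemma exists_setLIntegral_Iic_le (hμ : IsDoublingMeasure μ) :
    ∃ A : ℝ, 0 < A ∧ ∀ r ∈ Ico (0 : ℝ) 1,
      ∫⁻ t in Iic r, ENNReal.ofReal (1 / ((1 - t) * tail μ t)) ∂μ ≤
        ENNReal.ofReal (A / (1 - r)) := by
  have hfin := hμ.finite
  obtain ⟨p, hp⟩ := hμ.upper
  set F : ℝ → ℝ≥0∞ := fun r => ∫⁻ t in Iic r, ENNReal.ofReal (1 / ((1 - t) * tail μ t)) ∂μ
    with hF
  have hstep : ∀ r ∈ Ico (0 : ℝ) 1,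
      F ((1 + r) / 2) ≤ F r + ENNReal.ofReal (2 * 2 ^ p / (1 - r)) := by
    intro r hr
    have hlt : r ≤ (1 + r) / 2 := by linarith [hr.2]
    have h1r : 0 < 1 - r := by linarith [hr.2]
    have hT := hμ.tail_pos ((1 + r) / 2) (by linarith [hr.2])
    simp only [hF]
    rw [← Iic_union_Ioc_eq_Iic hlt, lintegral_union measurableSet_Ioc (by
      rw [Set.disjoint_left]; intro a ha hb; exact absurd hb.1 (not_lt.2 ha))]
    gcongr
    calc ∫⁻ t in Ioc r ((1 + r) / 2), ENNReal.ofReal (1 / ((1 - t) * tail μ t)) ∂μ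
        ≤ ∫⁻ t in Ioc r ((1 + r) / 2),
            ENNReal.ofReal (2 / ((1 - r) * tail μ ((1 + r) / 2))) ∂μ := by
          refine setLIntegral_mono' measurableSet_Ioc fun t ht => ENNReal.ofReal_le_ofReal ?_
          have h1 := hμ.tail_antitone ht.2
          have h2 : (1 - r) / 2 ≤ 1 - t := by linarith [ht.2]
          calc 1 / ((1 - t) * tail μ t) ≤ 1 / ((1 - r) / 2 * tail μ ((1 + r) / 2)) := by
                gcongr
                linarith
            _ = _ := by field_simp
      _ = ENNReal.ofReal (2 / ((1 - r) * tail μ ((1 + r) / 2))) * μ (Ioc r ((1 + r) / 2)) := by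
          rw [setLIntegral_const]
      _ ≤ ENNReal.ofReal (2 / ((1 - r) * tail μ ((1 + r) / 2))) * μ (Ioi r) := by
          gcongr; exact Ioc_subset_Ioi_self
      _ = ENNReal.ofReal (2 / ((1 - r) * tail μ ((1 + r) / 2)) * tail μ r) := by
          rw [ENNReal.ofReal_mul (by positivity), tail, tail, ofReal_measureReal]
      _ ≤ _ := by
          refine ENNReal.ofReal_le_ofReal ?_
          rw [div_mul_eq_mul_div, div_le_div_iff₀ (by positivity) h1r]
          have := hp r hr
          nlinarith
  refine ⟨2 * 2 ^ p, by positivity, ?_⟩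
  have hzero : F 0 = 0 := by
    simp only [hF]
    have : μ.restrict (Iic 0) = 0 := by
      rw [Measure.restrict_eq_zero]
      refine measure_mono_null ?_ (ae_iff.1 hμ.ae_mem)
      intro a ha hb
      exact absurd hb.1 (not_lt.2 ha)
    rw [this]; simp
  have hmain : ∀ k : ℕ, ∀ r ∈ Ico (0 : ℝ) 1, r ≤ 1 - 1 / 2 ^ k →
      F r ≤ ENNReal.ofReal (2 * 2 ^ p / (1 - r)) := by
    intro k
    induction k with
    | zero =>
      intro r hr hk
      have : r = 0 := le_antisymm (by simpa using hk) hr.1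
      rw [this, hzero]; simp
    | succ k ih =>
      intro r hr hk
      have h1r : 0 < 1 - r := by linarith [hr.2]
      by_cases h : r ≤ 1 / 2
      · have hmono : F r ≤ F ((1 + 0) / 2) :=
          lintegral_mono_set (Iic_subset_Iic.2 (by linarith))
        refine hmono.trans ((hstep 0 (by simp)).trans ?_)
        rw [hzero, zero_add]
        refine ENNReal.ofReal_le_ofReal ?_
        gcongr
        linarith [hr.1]
      -- Here `r` is the dyadic successor of `2r - 1`, which lies in the range of the induction
      -- hypothesis.
      · push Not at h
        have hs : 2 * r - 1 ∈ Ico (0 : ℝ) 1 := ⟨by linarith, by linarith⟩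
        have h2 := hstep _ hs
        have h3 := ih _ hs (by
          rw [pow_succ] at hk
          have : (1 : ℝ) / 2 ^ k = 2 * (1 / (2 ^ k * 2)) := by field_simp
          linarith)
        rw [show (1 + (2 * r - 1)) / 2 = r by ring] at h2
        refine h2.trans ((add_le_add_left h3 _).trans ?_)
        rw [← ENNReal.ofReal_add (by apply div_nonneg <;> [positivity; linarith])
          (by apply div_nonneg <;> [positivity; linarith])]
        refine ENNReal.ofReal_le_ofReal (le_of_eq ?_)
        rw [show 1 - (2 * r - 1) = 2 * (1 - r) by ring]
        field_simp
        norm_num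
  intro r hr
  obtain ⟨k, hk⟩ := exists_pow_lt_of_lt_one (show 0 < 1 - r by linarith [hr.2])
    (show (1 / 2 : ℝ) < 1 by norm_num)
  refine hmain k r hr ?_
  rw [div_pow, one_pow] at hk
  linarith

/-- For `t ≤ r` the point `rt` is replaced by `t`, and the previous lemma applies. For `t > r` it is
replaced by `r`, and the mass `T(r)` cancels the tail in the denominator. -/
lemma exists_lintegral_inv_tail_le (hμ : IsDoublingMeasure μ) :
    ∃ A : ℝ, 0 < A ∧ ∀ r ∈ Ico (0 : ℝ) 1,
      ∫⁻ t, ENNReal.ofReal (1 / ((1 - r * t) * tail μ (r * t))) ∂μ ≤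
        ENNReal.ofReal (A / (1 - r)) := by
  have hfin := hμ.finite
  obtain ⟨A, hA, hAb⟩ := hμ.exists_setLIntegral_Iic_le
  refine ⟨A + 1, by positivity, fun r hr => ?_⟩
  have h1r : 0 < 1 - r := by linarith [hr.2]
  have hT := hμ.tail_pos r hr.2
  rw [← lintegral_add_compl _ (measurableSet_Iic (a := r)), compl_Iic, add_div,
    ENNReal.ofReal_add (by positivity) (by positivity)]
  refine add_le_add (le_trans ?_ (hAb r hr)) ?_
  · refine lintegral_mono_ae ?_
    filter_upwards [ae_restrict_mem measurableSet_Iic, ae_restrict_of_ae hμ.ae_mem] with t ht ht'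
    refine ENNReal.ofReal_le_ofReal ?_
    have h1 : r * t ≤ t := by nlinarith [ht'.1, hr.2]
    have h2 := hμ.tail_antitone h1
    have h3 := hμ.tail_pos t ht'.2
    have h4 : 0 < 1 - t := by linarith [ht'.2]
    gcongr
    linarith
  · calc ∫⁻ t in Ioi r, ENNReal.ofReal (1 / ((1 - r * t) * tail μ (r * t))) ∂μ
        ≤ ∫⁻ t in Ioi r, ENNReal.ofReal (1 / ((1 - r) * tail μ r)) ∂μ := by
          refine lintegral_mono_ae ?_
          filter_upwards [ae_restrict_of_ae hμ.ae_mem] with t ht'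
          refine ENNReal.ofReal_le_ofReal ?_
          have h1 : r * t ≤ r := by nlinarith [ht'.2, hr.1]
          have h2 := hμ.tail_antitone h1
          gcongr
          linarith
      _ = ENNReal.ofReal (1 / ((1 - r) * tail μ r) * tail μ r) := by
          rw [setLIntegral_const, ENNReal.ofReal_mul (by positivity)]
          congr 1
          rw [tail, ofReal_measureReal]
      _ ≤ _ := by
          refine ENNReal.ofReal_le_ofReal (le_of_eq ?_)
          field_simp

end IsDoublingMeasure

/-! ### Power series on the disk and integration against `ω dA` -/

section PowerSeries

variable {a : ℕ → ℂ}

lemma differentiableOn_powerSeries (ha : ∀ r ∈ Ico (0 : ℝ) 1, Summable fun n => ‖a n‖ * r ^ n) :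
    DifferentiableOn ℂ (fun z => ∑' n, a n * z ^ n) (ball 0 1) := by
  intro z hz
  have hz1 : ‖z‖ < 1 := by simpa using hz
  obtain ⟨r, hr1, hr2⟩ := exists_between hz1
  have h := Complex.differentiableOn_tsum_of_summable_norm (F := fun n (z : ℂ) => a n * z ^ n)
    (U := ball 0 r) (ha r ⟨(norm_nonneg z).trans hr1.le, hr2⟩)
    (fun n => by fun_prop) isOpen_ball (fun n w hw => by
      have hw' : ‖w‖ < r := by simpa using hw
      rw [norm_mul, norm_pow]
      gcongr)
  exact (h.differentiableAt (isOpen_ball.mem_nhds (by simpa using hr1))).differentiableWithinAt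

lemma hasSum_deriv_powerSeries
    (ha : ∀ r ∈ Ico (0 : ℝ) 1, Summable fun n => ‖a n‖ * r ^ n) {z : ℂ} (hz : z ∈ ball (0 : ℂ) 1) :
    HasSum (fun n : ℕ => (n + 1) * a (n + 1) * z ^ n) (deriv (fun z => ∑' n, a n * z ^ n) z) := by
  have hz1 : ‖z‖ < 1 := by simpa using hz
  obtain ⟨r, hr1, hr2⟩ := exists_between hz1
  have h := Complex.hasSum_deriv_of_summable_norm (F := fun n (z : ℂ) => a n * z ^ n) (z := z)
    (U := ball 0 r) (ha r ⟨(norm_nonneg z).trans hr1.le, hr2⟩)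
    (fun n => by fun_prop) isOpen_ball (fun n w hw => by
      have hw' : ‖w‖ < r := by simpa using hw
      rw [norm_mul, norm_pow]
      gcongr) (by simpa using hr1)
  rw [← hasSum_nat_add_iff' 1] at h
  simp only [Finset.range_one, Finset.sum_singleton, pow_zero, mul_one, deriv_const, sub_zero] at h
  convert! h using 1
  ext n
  simp
  ring

end PowerSeries

lemma aestronglyMeasurable_weightMeasure {ω : ℂ → ℝ} {E : Type*} [NormedAddCommGroup E]
    {F : ℂ → E} (hF : ContinuousOn F (ball 0 1)) :
    AEStronglyMeasurable F (weightMeasure ω) :=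
  (hF.aestronglyMeasurable measurableSet_ball).mono_ac (weightMeasure_absolutelyContinuous ω)

namespace IsRadialWeight

variable {ω : ℂ → ℝ}

lemma integrable_weightMeasure_iff (hω : IsRadialWeight ω) {E : Type*} [NormedAddCommGroup E]
    [NormedSpace ℝ E] {F : ℂ → E} :
    Integrable F (weightMeasure ω) ↔ Integrable (fun ξ => ω ξ • F ξ) diskArea := by
  rw [weightMeasure, integrable_withDensity_iff_integrable_smul₀'
    hω.integrable.aestronglyMeasurable.aemeasurable.ennreal_ofReal (by simp)]
  refine integrable_congr ?_
  have h : ∀ᵐ z ∂diskArea, z ∈ ball (0 : ℂ) 1 :=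
    Measure.smul_absolutelyContinuous.ae_le (ae_restrict_mem measurableSet_ball)
  filter_upwards [h] with z hz
  rw [ENNReal.toReal_ofReal (hω.nonneg z hz)]

lemma integral_weightMeasure_eq (hω : IsRadialWeight ω) {E : Type*} [NormedAddCommGroup E]
    [NormedSpace ℝ E] (F : ℂ → E) :
    ∫ ξ, F ξ ∂weightMeasure ω = ∫ ξ, ω ξ • F ξ ∂diskArea := by
  rw [weightMeasure, integral_withDensity_eq_integral_toReal_smul₀
    hω.integrable.aestronglyMeasurable.aemeasurable.ennreal_ofReal (by simp)]
  refine integral_congr_ae ?_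
  have h : ∀ᵐ z ∂diskArea, z ∈ ball (0 : ℂ) 1 :=
    Measure.smul_absolutelyContinuous.ae_le (ae_restrict_mem measurableSet_ball)
  filter_upwards [h] with z hz
  rw [ENNReal.toReal_ofReal (hω.nonneg z hz)]

lemma integral_weightMeasure_polar (hω : IsRadialWeight ω) {F : ℂ → ℂ}
    (hF : Integrable F (weightMeasure ω)) :
    ∫ ξ, F ξ ∂weightMeasure ω =
      ∫ t, ∫ θ, F (polarPoint t θ) ∂angleMeasure ∂radialMeasure ω := by
  have hpp : Measurable fun p : ℝ × ℝ => polarPoint p.1 p.2 := by fun_prop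
  have hfin := hω.isFiniteMeasure_radialMeasure
  rw [hω.weightMeasure_eq_map] at hF ⊢
  rw [integral_map hpp.aemeasurable hF.aestronglyMeasurable]
  exact integral_prod _ ((integrable_map_measure hF.aestronglyMeasurable hpp.aemeasurable).1 hF)

lemma lintegral_weightMeasure_polar (hω : IsRadialWeight ω) {F : ℂ → ℝ≥0∞}
    (hF : AEMeasurable F (weightMeasure ω)) :
    ∫⁻ ξ, F ξ ∂weightMeasure ω =
      ∫⁻ t, ∫⁻ θ, F (polarPoint t θ) ∂angleMeasure ∂radialMeasure ω := by
  have hpp : Measurable fun p : ℝ × ℝ => polarPoint p.1 p.2 := by fun_prop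
  have hfin := hω.isFiniteMeasure_radialMeasure
  rw [hω.weightMeasure_eq_map] at hF ⊢
  rw [lintegral_map' hF hpp.aemeasurable]
  exact lintegral_prod _ (hF.comp_measurable hpp)

lemma integrable_of_continuousOn_of_bound (hω : IsRadialWeight ω) {F : ℂ → ℂ}
    (hF : ContinuousOn F (ball 0 1)) (C : ℝ) (hC : ∀ z ∈ ball (0 : ℂ) 1, ‖F z‖ ≤ C) :
    Integrable F (weightMeasure ω) := by
  have := hω.isFiniteMeasure_weightMeasure
  exact Integrable.of_bound (aestronglyMeasurable_weightMeasure hF) C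
    ((ae_weightMeasure_mem_ball ω).mono hC)

end IsRadialWeight

/-- Termwise integration against an absolutely convergent power series in `z * conj ξ`. -/
lemma hasSum_integral_mul_powerSeries {ω : ℂ → ℝ} {F : ℂ → ℂ}
    (hF : Integrable F (weightMeasure ω)) {a : ℕ → ℂ} {z : ℂ}
    (ha : Summable fun n => ‖a n‖ * ‖z‖ ^ n) :
    HasSum (fun n => a n * (∫ ξ, F ξ * conj ξ ^ n ∂weightMeasure ω) * z ^ n)
      (∫ ξ, F ξ * ∑' n, a n * (z * conj ξ) ^ n ∂weightMeasure ω) := by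
  have hm : ∀ n, AEStronglyMeasurable (fun ξ => F ξ * (a n * (z * conj ξ) ^ n))
      (weightMeasure ω) := fun n =>
    hF.aestronglyMeasurable.mul
      ((by fun_prop : Continuous fun ξ : ℂ => a n * (z * conj ξ) ^ n).aestronglyMeasurable)
  have hb : ∀ n, ∀ᵐ ξ ∂weightMeasure ω,
      ‖F ξ * (a n * (z * conj ξ) ^ n)‖ ≤ ‖a n‖ * ‖z‖ ^ n * ‖F ξ‖ := by
    intro n
    filter_upwards [ae_weightMeasure_mem_ball ω] with ξ hξ
    have hξ1 : ‖ξ‖ ^ n ≤ 1 := pow_le_one₀ (norm_nonneg _) (mem_ball_zero_iff.1 hξ).le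
    rw [norm_mul, norm_mul, norm_pow, norm_mul, RCLike.norm_conj, mul_pow]
    calc ‖F ξ‖ * (‖a n‖ * (‖z‖ ^ n * ‖ξ‖ ^ n)) ≤ ‖F ξ‖ * (‖a n‖ * (‖z‖ ^ n * 1)) := by gcongr
      _ = _ := by ring
  have hi : ∀ n, Integrable (fun ξ => F ξ * (a n * (z * conj ξ) ^ n)) (weightMeasure ω) :=
    fun n => (hF.norm.const_mul _).mono' (hm n) (hb n)
  have h := hasSum_integral_of_summable_integral_norm hi (by
    refine Summable.of_nonneg_of_le (fun n => integral_nonneg fun _ => norm_nonneg _)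
      (fun n => ?_) (ha.mul_right (∫ ξ, ‖F ξ‖ ∂weightMeasure ω))
    rw [← integral_const_mul]
    exact integral_mono_ae (hi n).norm (hF.norm.const_mul _) (hb n))
  convert! h using 1
  · ext n
    rw [mul_right_comm, ← integral_const_mul]
    congr 1
    ext ξ
    rw [mul_pow]; ring
  · congr 1
    ext ξ
    rw [tsum_mul_left]

lemma integrable_mul_conj_pow {ω : ℂ → ℝ} {Φ : ℂ → ℂ} (hΦ : Integrable Φ (weightMeasure ω))
    (n : ℕ) : Integrable (fun ξ => Φ ξ * conj ξ ^ n) (weightMeasure ω) := by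
  refine hΦ.mono (hΦ.aestronglyMeasurable.mul
    (by fun_prop : Continuous fun ξ : ℂ => conj ξ ^ n).aestronglyMeasurable) ?_
  filter_upwards [ae_weightMeasure_mem_ball ω] with ξ hξ
  rw [norm_mul, norm_pow, RCLike.norm_conj]
  exact mul_le_of_le_one_right (norm_nonneg _)
    (pow_le_one₀ (norm_nonneg _) (mem_ball_zero_iff.1 hξ).le)

/-- Orthogonality acts on each circle separately, so the coefficients may vary with the radius.
Constant coefficients give analytic `f`; the dependence on `t` is needed for the non-analytic
preimages in the surjectivity argument. -/
lemma IsRadialWeight.integral_powerSeries_mul_conj_pow {ω : ℂ → ℝ} (hω : IsRadialWeight ω)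
    {f : ℂ → ℂ} (hf : Integrable f (weightMeasure ω)) {a : ℝ → ℕ → ℂ}
    (ha : ∀ t ∈ Ioo (0 : ℝ) 1, Summable fun n => ‖a t n‖ * t ^ n)
    (hfa : ∀ t ∈ Ioo (0 : ℝ) 1, ∀ θ, f (polarPoint t θ) = ∑' n, a t n * polarPoint t θ ^ n)
    (n : ℕ) :
    ∫ ξ, f ξ * conj ξ ^ n ∂weightMeasure ω = ∫ t, a t n * (t : ℂ) ^ (2 * n) ∂radialMeasure ω := by
  rw [hω.integral_weightMeasure_polar (integrable_mul_conj_pow hf n)]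
  refine integral_congr_ae ?_
  filter_upwards [ae_radialMeasure_mem ω] with t ht
  simp_rw [hfa t ht]
  exact integral_angleMeasure_tsum_mul_conj_pow ht.1.le (ha t ht) n

/-- Taylor coefficients at the origin. -/
def taylorCoeff (f : ℂ → ℂ) (n : ℕ) : ℂ := (n.factorial : ℂ)⁻¹ * iteratedDeriv n f 0

lemma hasSum_taylorCoeff {f : ℂ → ℂ} (hf : DifferentiableOn ℂ f (ball 0 1)) {z : ℂ}
    (hz : z ∈ ball (0 : ℂ) 1) : HasSum (fun n => taylorCoeff f n * z ^ n) (f z) := by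
  have h := Complex.hasSum_taylorSeries_on_ball (r := 1) (by simpa using hf) (z := z)
    (by simpa using hz)
  convert! h using 1
  ext n
  simp [taylorCoeff]
  ring

lemma summable_norm_taylorCoeff {f : ℂ → ℂ} (hf : DifferentiableOn ℂ f (ball 0 1)) {r : ℝ}
    (hr : r ∈ Ico (0 : ℝ) 1) : Summable fun n => ‖taylorCoeff f n‖ * r ^ n := by
  obtain ⟨s, hs1, hs2⟩ := exists_between hr.2
  have hs0 : 0 < s := hr.1.trans_lt hs1
  have hs := (hasSum_taylorCoeff hf (z := (s : ℂ)) (by simpa [abs_of_pos hs0] using hs2)).summable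
  obtain ⟨C, hC⟩ := (hs.tendsto_atTop_zero.norm.bddAbove_range)
  have hC' : ∀ n, ‖taylorCoeff f n‖ * s ^ n ≤ C := by
    intro n
    have := hC (mem_range_self n)
    simpa [abs_of_pos hs0] using this
  have hq : r / s < 1 := by rw [div_lt_one hs0]; exact hs1
  refine Summable.of_nonneg_of_le (fun n => mul_nonneg (norm_nonneg _) (pow_nonneg hr.1 n))
    (fun n => ?_) ((summable_geometric_of_lt_one (div_nonneg hr.1 hs0.le) hq).mul_left C)
  have h1 : r ^ n = s ^ n * (r / s) ^ n := by
    rw [← mul_pow]; congr 1; field_simp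
  rw [h1, ← mul_assoc]
  exact mul_le_mul_of_nonneg_right (hC' n) (pow_nonneg (div_nonneg hr.1 hs0.le) n)

lemma taylorCoeff_deriv (f : ℂ → ℂ) (n : ℕ) :
    taylorCoeff (deriv f) n = (n + 1) * taylorCoeff f (n + 1) := by
  have : ((n : ℂ) + 1) ≠ 0 := by exact_mod_cast n.succ_ne_zero
  rw [taylorCoeff, taylorCoeff, iteratedDeriv_succ', Nat.factorial_succ]
  push_cast
  field_simp

/-! ### The Bergman kernel and the Taylor coefficients of the projection -/

/-- The power series with the inverse moments as coefficients: `B_z^ω(ξ)` is its value at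
`conj z * ξ`. -/
def kernelSeries (μ : Measure ℝ) (w : ℂ) : ℂ := ∑' n, ((moment μ n)⁻¹ : ℂ) * w ^ n

namespace IsDoublingMeasure

variable {μ : Measure ℝ}

lemma norm_inv_moment (hμ : IsDoublingMeasure μ) (n : ℕ) :
    ‖((moment μ n)⁻¹ : ℂ)‖ = (moment μ n)⁻¹ := by
  rw [norm_inv, Complex.norm_real, Real.norm_of_nonneg (hμ.moment_pos n).le]

lemma summable_norm_inv_moment (hμ : IsDoublingMeasure μ) {r : ℝ} (hr : r ∈ Ico (0 : ℝ) 1) :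
    Summable fun n => ‖((moment μ n)⁻¹ : ℂ)‖ * r ^ n := by
  simpa [hμ.norm_inv_moment] using hμ.summable_pow_div_moment 0 hr

lemma differentiableOn_kernelSeries (hμ : IsDoublingMeasure μ) :
    DifferentiableOn ℂ (kernelSeries μ) (ball 0 1) :=
  differentiableOn_powerSeries fun _ hr => hμ.summable_norm_inv_moment hr

lemma norm_kernelSeries_le (hμ : IsDoublingMeasure μ) {r : ℝ} (hr : r ∈ Ico (0 : ℝ) 1) {w : ℂ}
    (hw : ‖w‖ ≤ r) : ‖kernelSeries μ w‖ ≤ ∑' n, (moment μ n)⁻¹ * r ^ n := by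
  have hs := hμ.summable_norm_inv_moment hr
  refine tsum_of_norm_bounded (hs.congr fun n => by rw [hμ.norm_inv_moment]).hasSum fun n => ?_
  have := hμ.moment_pos n
  rw [norm_mul, norm_pow, hμ.norm_inv_moment]
  gcongr

end IsDoublingMeasure

lemma conj_kernelSeries (μ : Measure ℝ) (z ξ : ℂ) :
    conj (kernelSeries μ (conj z * ξ)) = ∑' n, ((moment μ n)⁻¹ : ℂ) * (z * conj ξ) ^ n := by
  rw [kernelSeries]
  refine (Complex.conjCLE.map_tsum
    (f := fun n => ((moment μ n)⁻¹ : ℂ) * (conj z * ξ) ^ n)).trans ?_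
  simp

lemma conj_mul_mem_ball {z ξ : ℂ} (hz : z ∈ ball (0 : ℂ) 1) (hξ : ξ ∈ ball (0 : ℂ) 1) :
    conj z * ξ ∈ ball (0 : ℂ) 1 := by
  rw [mem_ball_zero_iff] at *
  rw [norm_mul, RCLike.norm_conj]
  nlinarith [norm_nonneg z, norm_nonneg ξ]

namespace IsDoublingWeight

variable {ω : ℂ → ℝ}

lemma differentiableOn_kernel (hω : IsDoublingWeight ω) {z : ℂ} (hz : z ∈ ball (0 : ℂ) 1) :
    DifferentiableOn ℂ (fun ξ => kernelSeries (radialMeasure ω) (conj z * ξ)) (ball 0 1) :=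
  hω.isDoublingMeasure.differentiableOn_kernelSeries.comp (by fun_prop)
    fun _ hξ => conj_mul_mem_ball hz hξ

lemma exists_norm_kernel_le (hω : IsDoublingWeight ω) {z : ℂ} (hz : z ∈ ball (0 : ℂ) 1) :
    ∃ C : ℝ, ∀ ξ ∈ ball (0 : ℂ) 1, ‖kernelSeries (radialMeasure ω) (conj z * ξ)‖ ≤ C := by
  refine ⟨_, fun ξ hξ => hω.isDoublingMeasure.norm_kernelSeries_le
    (r := ‖z‖) ⟨norm_nonneg _, by simpa using hz⟩ ?_⟩
  rw [norm_mul, RCLike.norm_conj]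
  exact mul_le_of_le_one_right (norm_nonneg _) (mem_ball_zero_iff.1 hξ).le

end IsDoublingWeight

namespace IsRadialWeight

variable {ω : ℂ → ℝ}

lemma memBergmanTwo_iff (hω : IsRadialWeight ω) {f : ℂ → ℂ} :
    MemBergmanTwo ω f ↔ DifferentiableOn ℂ f (ball 0 1) ∧
      Integrable (fun ξ => ‖f ξ‖ ^ 2) (weightMeasure ω) := by
  rw [MemBergmanTwo, hω.integrable_weightMeasure_iff]
  simp only [smul_eq_mul, mul_comm]

lemma isReproducingKernelAt_iff (hω : IsRadialWeight ω) {z : ℂ} {k : ℂ → ℂ} :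
    IsReproducingKernelAt ω z k ↔ MemBergmanTwo ω k ∧ ∀ f, MemBergmanTwo ω f →
      f z = ∫ ξ, f ξ * conj (k ξ) ∂weightMeasure ω := by
  simp only [IsReproducingKernelAt, hω.integral_weightMeasure_eq]
  refine and_congr_right fun _ => forall_congr' fun f => imp_congr_right fun _ => ?_
  rw [show (fun ξ => f ξ * conj (k ξ) * (ω ξ : ℂ)) = fun ξ => ω ξ • (f ξ * conj (k ξ)) by
    ext ξ; rw [Complex.real_smul]; ring]

lemma integrable_mul_conj (hω : IsRadialWeight ω) {f g : ℂ → ℂ} (hf : MemBergmanTwo ω f)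
    (hg : MemBergmanTwo ω g) : Integrable (fun ξ => f ξ * conj (g ξ)) (weightMeasure ω) := by
  rw [hω.memBergmanTwo_iff] at hf hg
  refine (hf.2.add hg.2).mono' ?_ (Eventually.of_forall fun ξ => ?_)
  · exact (aestronglyMeasurable_weightMeasure hf.1.continuousOn).mul
      (Complex.continuous_conj.comp_aestronglyMeasurable
        (aestronglyMeasurable_weightMeasure hg.1.continuousOn))
  · simp only [norm_mul, RCLike.norm_conj, Pi.add_apply]
    nlinarith [sq_nonneg (‖f ξ‖ - ‖g ξ‖), sq_nonneg (‖f ξ‖), sq_nonneg ‖g ξ‖]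

lemma memBergmanTwo_sub (hω : IsRadialWeight ω) {f g : ℂ → ℂ} (hf : MemBergmanTwo ω f)
    (hg : MemBergmanTwo ω g) : MemBergmanTwo ω (fun ξ => f ξ - g ξ) := by
  rw [hω.memBergmanTwo_iff] at *
  refine ⟨hf.1.sub hg.1, ?_⟩
  refine ((hf.2.add hg.2).const_mul 2).mono' ?_ (Eventually.of_forall fun ξ => ?_)
  · exact ((aestronglyMeasurable_weightMeasure (hf.1.sub hg.1).continuousOn).norm.pow 2)
  · simp only [Pi.add_apply]
    rw [Real.norm_of_nonneg (by positivity)]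
    have := norm_sub_le (f ξ) (g ξ)
    have h2 : ‖f ξ - g ξ‖ ^ 2 ≤ (‖f ξ‖ + ‖g ξ‖) ^ 2 := by gcongr
    nlinarith [sq_nonneg (‖f ξ‖ - ‖g ξ‖)]

/-- Reproducing kernels are unique almost everywhere. -/
lemma ae_eq_of_isReproducingKernelAt (hω : IsRadialWeight ω) {z : ℂ} {k l : ℂ → ℂ}
    (hk : IsReproducingKernelAt ω z k) (hl : IsReproducingKernelAt ω z l) :
    k =ᵐ[weightMeasure ω] l := by
  rw [hω.isReproducingKernelAt_iff] at hk hl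
  have hd := hω.memBergmanTwo_sub hk.1 hl.1
  have h1 := hk.2 _ hd
  have h2 := hl.2 _ hd
  -- Both kernels reproduce the value of `k - l` at `z`, so `k - l` is orthogonal to itself.
  have h3 : ∫ ξ, ((‖k ξ - l ξ‖ ^ 2 : ℝ) : ℂ) ∂weightMeasure ω = 0 := by
    have : ∀ ξ, ((‖k ξ - l ξ‖ ^ 2 : ℝ) : ℂ) =
        (k ξ - l ξ) * conj (k ξ) - (k ξ - l ξ) * conj (l ξ) := by
      intro ξ
      rw [← mul_sub, ← map_sub, Complex.mul_conj']
      push_cast; rfl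
    simp_rw [this]
    rw [integral_sub (hω.integrable_mul_conj hd hk.1) (hω.integrable_mul_conj hd hl.1), ← h1, ← h2,
      sub_self]
  rw [integral_complex_ofReal] at h3
  have h4 := (integral_eq_zero_iff_of_nonneg (fun ξ => by positivity)
    (hω.memBergmanTwo_iff.1 hd).2).1 (by exact_mod_cast h3)
  filter_upwards [h4] with ξ hξ
  simpa [sub_eq_zero] using hξ

lemma integrable_of_memBergmanTwo (hω : IsRadialWeight ω) {f : ℂ → ℂ} (hf : MemBergmanTwo ω f) :
    Integrable f (weightMeasure ω) := by
  have := hω.isFiniteMeasure_weightMeasure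
  rw [hω.memBergmanTwo_iff] at hf
  refine (hf.2.add (integrable_const 1)).mono'
    (aestronglyMeasurable_weightMeasure hf.1.continuousOn) (Eventually.of_forall fun ξ => ?_)
  simp only [Pi.add_apply]
  nlinarith [sq_nonneg (‖f ξ‖ - 1), sq_nonneg ‖f ξ‖]

lemma integral_mul_conj_pow (hω : IsRadialWeight ω) {f : ℂ → ℂ}
    (hf : Integrable f (weightMeasure ω)) (hd : DifferentiableOn ℂ f (ball 0 1)) (n : ℕ) :
    ∫ ξ, f ξ * conj ξ ^ n ∂weightMeasure ω = taylorCoeff f n * moment (radialMeasure ω) n := by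
  rw [hω.integral_powerSeries_mul_conj_pow hf (a := fun _ => taylorCoeff f)
    (fun t ht => summable_norm_taylorCoeff hd ⟨ht.1.le, ht.2⟩) (fun t ht θ => ?_) n]
  · rw [integral_const_mul, moment, ← integral_complex_ofReal]
    simp
  · exact (hasSum_taylorCoeff hd (by simpa [abs_of_pos ht.1] using ht.2)).tsum_eq.symm

end IsRadialWeight

namespace IsDoublingWeight

variable {ω : ℂ → ℝ}

lemma hasSum_integral_mul_kernel (hω : IsDoublingWeight ω) {F : ℂ → ℂ}
    (hF : Integrable F (weightMeasure ω)) {z : ℂ} (hz : z ∈ ball (0 : ℂ) 1) :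
    HasSum (fun n => ((moment (radialMeasure ω) n)⁻¹ : ℂ) *
        (∫ ξ, F ξ * conj ξ ^ n ∂weightMeasure ω) * z ^ n)
      (∫ ξ, F ξ * conj (kernelSeries (radialMeasure ω) (conj z * ξ)) ∂weightMeasure ω) := by
  simp_rw [conj_kernelSeries]
  exact hasSum_integral_mul_powerSeries hF
    (hω.isDoublingMeasure.summable_norm_inv_moment ⟨norm_nonneg _, by simpa using hz⟩)

/-- Integrating `f` against the series term by term produces `f_n m_n / m_n`, so the Taylor series
of `f` at `z` reappears. Square integrability is clear, as the series is bounded in `ξ` for fixed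
`z`. -/
theorem isReproducingKernelAt_kernelSeries (hω : IsDoublingWeight ω) {z : ℂ}
    (hz : z ∈ ball (0 : ℂ) 1) :
    IsReproducingKernelAt ω z fun ξ => kernelSeries (radialMeasure ω) (conj z * ξ) := by
  have hR := hω.toIsRadialWeight
  have := hR.isFiniteMeasure_weightMeasure
  rw [hR.isReproducingKernelAt_iff, hR.memBergmanTwo_iff]
  have hd := hω.differentiableOn_kernel hz
  refine ⟨⟨hd, ?_⟩, fun f hf => ?_⟩
  · obtain ⟨C, hC⟩ := hω.exists_norm_kernel_le hz
    refine Integrable.of_bound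
      ((aestronglyMeasurable_weightMeasure hd.continuousOn).norm.pow 2) (C ^ 2) ?_
    filter_upwards [ae_weightMeasure_mem_ball ω] with ξ hξ
    rw [Real.norm_of_nonneg (by positivity)]
    gcongr
    exact hC ξ hξ
  · have hfi := hR.integrable_of_memBergmanTwo hf
    have h1 := hω.hasSum_integral_mul_kernel hfi hz
    refine (hasSum_taylorCoeff hf.1 hz).unique ?_
    convert! h1 using 1
    ext n
    have : (moment (radialMeasure ω) n : ℂ) ≠ 0 := by
      exact_mod_cast (hω.isDoublingMeasure.moment_pos n).ne'
    rw [hR.integral_mul_conj_pow hfi hf.1]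
    field_simp

theorem isReproducingKernelAt_bergmanKernel (hω : IsDoublingWeight ω) {z : ℂ}
    (hz : z ∈ ball (0 : ℂ) 1) : IsReproducingKernelAt ω z (bergmanKernel ω z) := by
  have h : ∃ k, IsReproducingKernelAt ω z k := ⟨_, hω.isReproducingKernelAt_kernelSeries hz⟩
  rw [bergmanKernel, dif_pos h]
  exact h.choose_spec

lemma bergmanKernel_ae_eq (hω : IsDoublingWeight ω) {z : ℂ} (hz : z ∈ ball (0 : ℂ) 1) :
    bergmanKernel ω z =ᵐ[weightMeasure ω]
      fun ξ => kernelSeries (radialMeasure ω) (conj z * ξ) :=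
  hω.toIsRadialWeight.ae_eq_of_isReproducingKernelAt (hω.isReproducingKernelAt_bergmanKernel hz)
    (hω.isReproducingKernelAt_kernelSeries hz)

lemma bergmanIntegrand_eq (ω : ℂ → ℝ) (Φ : ℂ → ℂ) (z : ℂ) :
    bergmanIntegrand ω Φ z = fun ξ => ω ξ • (Φ ξ * conj (bergmanKernel ω z ξ)) := by
  ext ξ
  rw [bergmanIntegrand, Complex.real_smul]
  ring

theorem integrable_bergmanIntegrand (hω : IsDoublingWeight ω) {Φ : ℂ → ℂ}
    (hΦ : Integrable Φ (weightMeasure ω)) {z : ℂ} (hz : z ∈ ball (0 : ℂ) 1) :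
    Integrable (bergmanIntegrand ω Φ z) diskArea := by
  rw [bergmanIntegrand_eq, ← hω.toIsRadialWeight.integrable_weightMeasure_iff]
  obtain ⟨C, hC⟩ := hω.exists_norm_kernel_le hz
  have h : Integrable (fun ξ => Φ ξ * conj (kernelSeries (radialMeasure ω) (conj z * ξ)))
      (weightMeasure ω) := by
    refine (hΦ.norm.const_mul C).mono' (hΦ.aestronglyMeasurable.mul
      (Complex.continuous_conj.comp_aestronglyMeasurable
        (aestronglyMeasurable_weightMeasure (hω.differentiableOn_kernel hz).continuousOn))) ?_
    filter_upwards [ae_weightMeasure_mem_ball ω] with ξ hξ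
    rw [norm_mul, RCLike.norm_conj, mul_comm]
    gcongr
    exact hC ξ hξ
  refine h.congr ?_
  filter_upwards [hω.bergmanKernel_ae_eq hz] with ξ hξ
  rw [hξ]

/-- The Taylor coefficients of the Bergman projection of `Φ`. -/
def _root_.projCoeff (ω : ℂ → ℝ) (Φ : ℂ → ℂ) (n : ℕ) : ℂ :=
  ((moment (radialMeasure ω) n)⁻¹ : ℂ) * ∫ ξ, Φ ξ * conj ξ ^ n ∂weightMeasure ω

theorem hasSum_bergmanProjection (hω : IsDoublingWeight ω) {Φ : ℂ → ℂ}
    (hΦ : Integrable Φ (weightMeasure ω)) {z : ℂ} (hz : z ∈ ball (0 : ℂ) 1) :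
    HasSum (fun n => projCoeff ω Φ n * z ^ n) (bergmanProjection ω Φ z) := by
  convert! hω.hasSum_integral_mul_kernel hΦ hz using 1
  rw [bergmanProjection, bergmanIntegrand_eq, ← hω.toIsRadialWeight.integral_weightMeasure_eq]
  refine integral_congr_ae ?_
  filter_upwards [hω.bergmanKernel_ae_eq hz] with ξ hξ
  rw [hξ]

end IsDoublingWeight

/-! ### Boundedness into the Bloch space -/

/-- Coefficients of the derivative of the kernel series. -/
def derivCoeff (μ : Measure ℝ) (n : ℕ) : ℂ := (((n + 1) / moment μ (n + 1) : ℝ) : ℂ)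

lemma integrable_angleMeasure_of_continuous {E : Type*} [NormedAddCommGroup E] {f : ℝ → E}
    (hf : Continuous f) : Integrable f angleMeasure := by
  refine Integrable.smul_measure ?_ (by simp [Real.pi_pos])
  exact hf.integrableOn_Icc.mono_set Ioo_subset_Icc_self

namespace IsDoublingMeasure

variable {μ : Measure ℝ}

lemma norm_derivCoeff (hμ : IsDoublingMeasure μ) (n : ℕ) :
    ‖derivCoeff μ n‖ = (n + 1) / moment μ (n + 1) := by
  have := hμ.moment_pos (n + 1)
  rw [derivCoeff, Complex.norm_real, Real.norm_of_nonneg (by positivity)]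

lemma summable_norm_derivCoeff (hμ : IsDoublingMeasure μ) {r : ℝ} (hr : r ∈ Ico (0 : ℝ) 1) :
    Summable fun n => ‖derivCoeff μ n‖ * r ^ n := by
  obtain ⟨C, hC, hCb⟩ := hμ.exists_moment_le
  have h := ((hμ.summable_pow_div_moment 1 hr).add (hμ.summable_pow_div_moment 0 hr)).mul_left C
  refine Summable.of_nonneg_of_le (fun n => mul_nonneg (norm_nonneg _) (pow_nonneg hr.1 n))
    (fun n => ?_) h
  have hn := hμ.moment_pos n
  have hn1 := hμ.moment_pos (n + 1)
  have h1 : 1 / moment μ (n + 1) ≤ C / moment μ n := by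
    rw [div_le_div_iff₀ hn1 hn]; linarith [hCb n (n + 1) (by omega)]
  have hrn := pow_nonneg hr.1 n
  rw [hμ.norm_derivCoeff]
  calc (n + 1) / moment μ (n + 1) * r ^ n = (n + 1) * (1 / moment μ (n + 1)) * r ^ n := by ring
    _ ≤ (n + 1) * (C / moment μ n) * r ^ n := by gcongr
    _ = _ := by ring

/-- Summation by parts. The shifted sequence `n / m_n` vanishes at `n = 0`, so there is no boundary
term. -/
lemma one_sub_mul_derivSeries (hμ : IsDoublingMeasure μ) {w : ℂ} (hw : ‖w‖ < 1) :
    (1 - w) * ∑' n, derivCoeff μ n * w ^ n =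
      ∑' n : ℕ, (((n + 1) / moment μ (n + 1) - n / moment μ n : ℝ) : ℂ) * w ^ n := by
  have hr : ‖w‖ ∈ Ico (0 : ℝ) 1 := ⟨norm_nonneg _, hw⟩
  have h1 : Summable fun n => derivCoeff μ n * w ^ n :=
    Summable.of_norm (by simpa using hμ.summable_norm_derivCoeff hr)
  have h2 : HasSum (fun n : ℕ => ((n / moment μ n : ℝ) : ℂ) * w ^ n)
      (w * ∑' n, derivCoeff μ n * w ^ n) := by
    rw [← hasSum_nat_add_iff' 1]
    simp only [Finset.range_one, Finset.sum_singleton, Nat.cast_zero, zero_div,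
      Complex.ofReal_zero, zero_mul, sub_zero]
    convert! h1.hasSum.mul_left w using 1
    ext n
    rw [derivCoeff]; push_cast; ring
  rw [sub_mul, one_mul]
  refine ((h1.hasSum.sub h2).tsum_eq.symm.trans (tsum_congr fun n => ?_))
  rw [derivCoeff]; push_cast; ring

/-- The derivative series factors as `H · 1/(1-w)`. Both factors have square means computed by
Parseval, and the two sizes are balanced by weighting the arithmetic-geometric inequality with the
tail at `ρ = |z|t`. -/
lemma exists_integral_norm_derivSeries_le (hμ : IsDoublingMeasure μ) :
    ∃ C : ℝ, 0 < C ∧ ∀ z ∈ ball (0 : ℂ) 1, ∀ t ∈ Ioo (0 : ℝ) 1,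
      ∫ θ, ‖∑' n, derivCoeff μ n * (z * polarPoint t θ) ^ n‖ ∂angleMeasure ≤
        C / ((1 - ‖z‖ * t) * tail μ (‖z‖ * t)) := by
  obtain ⟨C₁, hC₁, hb₁⟩ := hμ.exists_abs_coeff_sub_le
  obtain ⟨C₂, hC₂, hb₂⟩ := hμ.exists_tsum_inv_moment_sq_le
  refine ⟨C₁ ^ 2 * C₂ + 1, by positivity, fun z hz t ht => ?_⟩
  have hz1 : ‖z‖ < 1 := by simpa using hz
  set ρ := ‖z‖ * t with hρ
  have ht0 := ht.1
  have hρ0 : 0 ≤ ρ := by positivity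
  have hρ1 : ρ < 1 := by nlinarith [norm_nonneg z, ht.2]
  have hρI : ρ ∈ Ico (0 : ℝ) 1 := ⟨hρ0, hρ1⟩
  have h1ρ : 0 < 1 - ρ := by linarith
  have hT := hμ.tail_pos ρ hρ1
  have hnw : ∀ θ, ‖z * polarPoint t θ‖ = ρ := by
    intro θ; rw [norm_mul, norm_polarPoint, abs_of_pos ht0]
  set b : ℕ → ℝ := fun n => (n + 1) / moment μ (n + 1) - n / moment μ n with hbdef
  obtain ⟨hs₂, ht₂⟩ := hb₂ ρ hρI
  have hbsum : Summable fun n => |b n| * ρ ^ n := by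
    refine Summable.of_nonneg_of_le (fun n => by positivity) (fun n => ?_)
      ((hμ.summable_pow_div_moment 0 hρI).mul_left C₁)
    calc |b n| * ρ ^ n ≤ C₁ / moment μ n * ρ ^ n := by gcongr; exact hb₁ n
      _ = _ := by rw [pow_zero]; ring
  have hHP := integral_angleMeasure_norm_sq_tsum (a := fun n => (b n : ℂ) * z ^ n) ht0.le
    (hbsum.congr fun n => by
      rw [norm_mul, norm_pow, Complex.norm_real, Real.norm_eq_abs, hρ, mul_pow]; ring)
  have hEP := integral_angleMeasure_norm_sq_tsum (a := fun n => z ^ n) ht0.le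
    ((summable_geometric_of_lt_one hρ0 hρ1).congr fun n => by rw [norm_pow, hρ, mul_pow])
  simp_rw [mul_assoc, ← mul_pow] at hHP
  simp_rw [← mul_pow] at hEP
  have hH : ∫ θ, ‖∑' n, (b n : ℂ) * (z * polarPoint t θ) ^ n‖ ^ 2 ∂angleMeasure ≤
      C₁ ^ 2 * C₂ / ((1 - ρ) * tail μ ρ ^ 2) := by
    rw [hHP]
    have hterm : ∀ n, ‖(b n : ℂ) * z ^ n‖ ^ 2 * t ^ (2 * n) ≤
        C₁ ^ 2 * (ρ ^ (2 * n) / moment μ n ^ 2) := by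
      intro n
      have h1 : |b n| ^ 2 ≤ (C₁ / moment μ n) ^ 2 := by gcongr; exact hb₁ n
      calc ‖(b n : ℂ) * z ^ n‖ ^ 2 * t ^ (2 * n) = |b n| ^ 2 * ρ ^ (2 * n) := by
            rw [norm_mul, norm_pow, Complex.norm_real, Real.norm_eq_abs, hρ]; ring
        _ ≤ (C₁ / moment μ n) ^ 2 * ρ ^ (2 * n) := by gcongr
        _ = _ := by ring
    have hsum := Summable.of_nonneg_of_le (fun n => by positivity) hterm (hs₂.mul_left (C₁ ^ 2))
    refine (hsum.tsum_le_tsum hterm (hs₂.mul_left _)).trans ?_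
    rw [tsum_mul_left, mul_div_assoc]
    gcongr
  have hE : ∫ θ, ‖∑' n, (z * polarPoint t θ) ^ n‖ ^ 2 ∂angleMeasure ≤ 1 / (1 - ρ) := by
    rw [hEP]
    have h1 : ∀ n : ℕ, ‖z ^ n‖ ^ 2 * t ^ (2 * n) = (ρ ^ 2) ^ n := by
      intro n; rw [norm_pow, hρ]; ring
    simp_rw [h1]
    rw [tsum_geometric_of_lt_one (by positivity) (by nlinarith), inv_eq_one_div]
    gcongr
    nlinarith
  have hcH : Continuous fun θ => ∑' n, (b n : ℂ) * (z * polarPoint t θ) ^ n := by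
    refine continuous_tsum (fun n => by fun_prop) hbsum fun n θ => ?_
    rw [norm_mul, norm_pow, hnw, Complex.norm_real, Real.norm_eq_abs]
  have hcE : Continuous fun θ => ∑' n, (z * polarPoint t θ) ^ n := by
    refine continuous_tsum (fun n => by fun_prop) (summable_geometric_of_lt_one hρ0 hρ1)
      fun n θ => ?_
    rw [norm_pow, hnw]
  have hcG : Continuous fun θ => ∑' n, derivCoeff μ n * (z * polarPoint t θ) ^ n := by
    refine continuous_tsum (fun n => by fun_prop) (hμ.summable_norm_derivCoeff hρI) fun n θ => ?_
    rw [norm_mul, norm_pow, hnw]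
  have hpt : ∀ θ, ‖∑' n, derivCoeff μ n * (z * polarPoint t θ) ^ n‖ ≤
      tail μ ρ * ‖∑' n, (b n : ℂ) * (z * polarPoint t θ) ^ n‖ ^ 2 +
        (tail μ ρ)⁻¹ * ‖∑' n, (z * polarPoint t θ) ^ n‖ ^ 2 := by
    intro θ
    set w := z * polarPoint t θ with hw
    have hw1 : ‖w‖ < 1 := by rw [hw, hnw]; exact hρ1
    have h1w : (1 - w) ≠ 0 := by
      intro h
      rw [sub_eq_zero] at h
      rw [← h] at hw1
      simp at hw1
    have hG : ∑' n, derivCoeff μ n * w ^ n = (∑' n, (b n : ℂ) * w ^ n) * ∑' n, w ^ n := by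
      rw [tsum_geometric_of_norm_lt_one hw1, ← hμ.one_sub_mul_derivSeries hw1]
      field_simp
    rw [hG, norm_mul]
    set x := ‖∑' n, (b n : ℂ) * w ^ n‖
    set y := ‖∑' n, w ^ n‖
    -- Completing the square even gives a factor 2 to spare, which is discarded.
    have h2 : tail μ ρ * x ^ 2 + (tail μ ρ)⁻¹ * y ^ 2 - 2 * (x * y) =
        (tail μ ρ)⁻¹ * (tail μ ρ * x - y) ^ 2 := by field_simp; ring
    have h3 : 0 ≤ (tail μ ρ)⁻¹ * (tail μ ρ * x - y) ^ 2 := by positivity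
    have h4 : 0 ≤ x * y := by positivity
    linarith
  have hiH : Integrable (fun θ => ‖∑' n, (b n : ℂ) * (z * polarPoint t θ) ^ n‖ ^ 2)
      angleMeasure := integrable_angleMeasure_of_continuous (hcH.norm.pow 2)
  have hiE : Integrable (fun θ => ‖∑' n, (z * polarPoint t θ) ^ n‖ ^ 2)
      angleMeasure := integrable_angleMeasure_of_continuous (hcE.norm.pow 2)
  calc _ ≤ ∫ θ, (tail μ ρ * ‖∑' n, (b n : ℂ) * (z * polarPoint t θ) ^ n‖ ^ 2 +
        (tail μ ρ)⁻¹ * ‖∑' n, (z * polarPoint t θ) ^ n‖ ^ 2) ∂angleMeasure :=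
        integral_mono (integrable_angleMeasure_of_continuous hcG.norm)
          ((hiH.const_mul _).add (hiE.const_mul _)) hpt
    _ = tail μ ρ * ∫ θ, ‖∑' n, (b n : ℂ) * (z * polarPoint t θ) ^ n‖ ^ 2 ∂angleMeasure +
        (tail μ ρ)⁻¹ * ∫ θ, ‖∑' n, (z * polarPoint t θ) ^ n‖ ^ 2 ∂angleMeasure := by
        rw [integral_add (hiH.const_mul _) (hiE.const_mul _), integral_const_mul,
          integral_const_mul]
    _ ≤ tail μ ρ * (C₁ ^ 2 * C₂ / ((1 - ρ) * tail μ ρ ^ 2)) +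
        (tail μ ρ)⁻¹ * (1 / (1 - ρ)) := by gcongr
    _ = _ := by field_simp

end IsDoublingMeasure

lemma norm_derivSeries_conj (μ : Measure ℝ) (z ξ : ℂ) :
    ‖∑' n, derivCoeff μ n * (z * conj ξ) ^ n‖ = ‖∑' n, derivCoeff μ n * (conj z * ξ) ^ n‖ := by
  rw [← RCLike.norm_conj (∑' n, derivCoeff μ n * (conj z * ξ) ^ n)]
  congr 1
  refine Eq.trans ?_ (Complex.conjCLE.map_tsum
    (f := fun n => derivCoeff μ n * (conj z * ξ) ^ n)).symm
  simp [derivCoeff]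

namespace IsDoublingWeight

variable {ω : ℂ → ℝ}

/-- The circle means are integrated in `t` against the radial measure. Conjugating the series makes
it analytic in `ξ`, whence the circle estimate is used at `conj z`. -/
lemma exists_lintegral_derivSeries_le (hω : IsDoublingWeight ω) :
    ∃ M : ℝ, 0 < M ∧ ∀ z ∈ ball (0 : ℂ) 1,
      ∫⁻ ξ, ‖∑' n, derivCoeff (radialMeasure ω) n * (z * conj ξ) ^ n‖ₑ ∂weightMeasure ω ≤
        ENNReal.ofReal (M / (1 - ‖z‖)) := by
  have hμ := hω.isDoublingMeasure
  obtain ⟨C, hC, hCb⟩ := hμ.exists_integral_norm_derivSeries_le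
  obtain ⟨A, hA, hAb⟩ := hμ.exists_lintegral_inv_tail_le
  refine ⟨C * A, by positivity, fun z hz => ?_⟩
  have hz1 : ‖z‖ < 1 := by simpa using hz
  have hzc : conj z ∈ ball (0 : ℂ) 1 := by simpa using hz1
  have henorm : ∀ ξ, ‖∑' n, derivCoeff (radialMeasure ω) n * (z * conj ξ) ^ n‖ₑ =
      ‖∑' n, derivCoeff (radialMeasure ω) n * (conj z * ξ) ^ n‖ₑ := by
    intro ξ
    rw [← ofReal_norm, ← ofReal_norm, norm_derivSeries_conj]
  simp_rw [henorm]
  have hd : DifferentiableOn ℂ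
      (fun ξ => ∑' n, derivCoeff (radialMeasure ω) n * (conj z * ξ) ^ n) (ball 0 1) :=
    (differentiableOn_powerSeries fun _ hr => hμ.summable_norm_derivCoeff hr).comp
      (by fun_prop) fun _ hξ => conj_mul_mem_ball hz hξ
  rw [hω.toIsRadialWeight.lintegral_weightMeasure_polar
    (aestronglyMeasurable_weightMeasure hd.continuousOn).enorm]
  calc _ ≤ ∫⁻ t, ENNReal.ofReal C *
        ENNReal.ofReal (1 / ((1 - ‖z‖ * t) * tail (radialMeasure ω) (‖z‖ * t)))
          ∂radialMeasure ω := by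
        refine lintegral_mono_ae ?_
        filter_upwards [ae_radialMeasure_mem ω] with t ht
        have h1 := hCb _ hzc t ht
        rw [RCLike.norm_conj] at h1
        have hc : Continuous fun θ =>
            ∑' n, derivCoeff (radialMeasure ω) n * (conj z * polarPoint t θ) ^ n :=
          hd.continuousOn.comp_continuous (by fun_prop)
            fun θ => by simpa [abs_of_pos ht.1] using ht.2
        rw [← ofReal_integral_norm_eq_lintegral_enorm (integrable_angleMeasure_of_continuous hc),
          ← ENNReal.ofReal_mul hC.le]
        refine ENNReal.ofReal_le_ofReal (h1.trans (le_of_eq ?_))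
        ring
    _ = ENNReal.ofReal C * ∫⁻ t,
        ENNReal.ofReal (1 / ((1 - ‖z‖ * t) * tail (radialMeasure ω) (‖z‖ * t)))
          ∂radialMeasure ω := lintegral_const_mul' _ _ (by simp)
    _ ≤ ENNReal.ofReal C * ENNReal.ofReal (A / (1 - ‖z‖)) := by
        gcongr
        exact hAb _ ⟨norm_nonneg _, hz1⟩
    _ = _ := by rw [← ENNReal.ofReal_mul hC.le]; congr 1; ring

lemma summable_norm_projCoeff (hω : IsDoublingWeight ω) {Φ : ℂ → ℂ}
    (hΦ : Integrable Φ (weightMeasure ω)) {r : ℝ} (hr : r ∈ Ico (0 : ℝ) 1) :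
    Summable fun n => ‖projCoeff ω Φ n‖ * r ^ n := by
  have hμ := hω.isDoublingMeasure
  refine Summable.of_nonneg_of_le (fun n => mul_nonneg (norm_nonneg _) (pow_nonneg hr.1 n))
    (fun n => ?_) ((hμ.summable_norm_inv_moment hr).mul_left (∫ ξ, ‖Φ ξ‖ ∂weightMeasure ω))
  have h1 : ‖∫ ξ, Φ ξ * conj ξ ^ n ∂weightMeasure ω‖ ≤ ∫ ξ, ‖Φ ξ‖ ∂weightMeasure ω := by
    refine norm_integral_le_of_norm_le hΦ.norm ?_
    filter_upwards [ae_weightMeasure_mem_ball ω] with ξ hξ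
    rw [norm_mul, norm_pow, RCLike.norm_conj]
    exact mul_le_of_le_one_right (norm_nonneg _)
      (pow_le_one₀ (norm_nonneg _) (mem_ball_zero_iff.1 hξ).le)
  rw [projCoeff, norm_mul]
  have h2 := mul_le_mul_of_nonneg_left h1
    (norm_nonneg ((moment (radialMeasure ω) n)⁻¹ : ℂ))
  calc _ ≤ ‖((moment (radialMeasure ω) n)⁻¹ : ℂ)‖ * (∫ ξ, ‖Φ ξ‖ ∂weightMeasure ω) * r ^ n :=
        mul_le_mul_of_nonneg_right h2 (pow_nonneg hr.1 n)
    _ = _ := by ring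

lemma eqOn_bergmanProjection (hω : IsDoublingWeight ω) {Φ : ℂ → ℂ}
    (hΦ : Integrable Φ (weightMeasure ω)) :
    EqOn (bergmanProjection ω Φ) (fun z => ∑' n, projCoeff ω Φ n * z ^ n) (ball 0 1) :=
  fun _ hz => (hω.hasSum_bergmanProjection hΦ hz).tsum_eq.symm

lemma differentiableOn_bergmanProjection (hω : IsDoublingWeight ω) {Φ : ℂ → ℂ}
    (hΦ : Integrable Φ (weightMeasure ω)) :
    DifferentiableOn ℂ (bergmanProjection ω Φ) (ball 0 1) :=
  (differentiableOn_powerSeries fun _ hr => hω.summable_norm_projCoeff hΦ hr).congr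
    (hω.eqOn_bergmanProjection hΦ)

lemma hasSum_deriv_bergmanProjection (hω : IsDoublingWeight ω) {Φ : ℂ → ℂ}
    (hΦ : Integrable Φ (weightMeasure ω)) {z : ℂ} (hz : z ∈ ball (0 : ℂ) 1) :
    HasSum (fun n : ℕ => (n + 1) * projCoeff ω Φ (n + 1) * z ^ n)
      (deriv (bergmanProjection ω Φ) z) := by
  rw [((hω.eqOn_bergmanProjection hΦ).eventuallyEq_of_mem
    (isOpen_ball.mem_nhds hz)).deriv_eq]
  exact hasSum_deriv_powerSeries (fun _ hr => hω.summable_norm_projCoeff hΦ hr) hz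

/-- The Bergman projection is bounded from bounded functions to the Bloch space. -/
theorem exists_blochNorm_bergmanProjection_le (hω : IsDoublingWeight ω) :
    ∃ M : ℝ≥0, ∀ (Φ : ℂ → ℂ) (S : ℝ≥0), ContinuousOn Φ (ball 0 1) →
      (∀ z ∈ ball (0 : ℂ) 1, ‖Φ z‖ ≤ S) → blochNorm (bergmanProjection ω Φ) ≤ M * S := by
  have hR := hω.toIsRadialWeight
  have hfin := hR.isFiniteMeasure_weightMeasure
  have hμ := hω.isDoublingMeasure
  obtain ⟨M, hM, hMb⟩ := hω.exists_lintegral_derivSeries_le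
  have hm0 := hμ.moment_pos 0
  -- This constant controls `|P_ω Φ(0)|`, the zeroth Taylor coefficient.
  set c₀ := (moment (radialMeasure ω) 0)⁻¹ * (weightMeasure ω).real univ with hc₀
  have hc₀0 : 0 ≤ c₀ := by positivity
  refine ⟨(2 * M).toNNReal + c₀.toNNReal, fun Φ S hΦc hΦS => ?_⟩
  have hΦ := hR.integrable_of_continuousOn_of_bound hΦc S hΦS
  rw [blochNorm, ENNReal.coe_add, add_mul]
  refine add_le_add (iSup₂_le fun z hz => ?_) ?_
  · have hz1 : ‖z‖ < 1 := by simpa using hz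
    have h1z : 0 < 1 - ‖z‖ := by linarith
    have hΦ' : Integrable (fun ξ => Φ ξ * conj ξ) (weightMeasure ω) := by
      refine hR.integrable_of_continuousOn_of_bound (hΦc.mul (by fun_prop)) S fun ξ hξ => ?_
      rw [norm_mul, RCLike.norm_conj]
      exact (mul_le_of_le_one_right (norm_nonneg _) (mem_ball_zero_iff.1 hξ).le).trans (hΦS ξ hξ)
    have hsum := hasSum_integral_mul_powerSeries hΦ'
      (hμ.summable_norm_derivCoeff (r := ‖z‖) ⟨norm_nonneg _, hz1⟩)
    -- Differentiation lowers the power of `z` but not that of `conj ξ`; the surplus factor `conj ξ`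
    -- is attached to `Φ`.
    have hder : deriv (bergmanProjection ω Φ) z = ∫ ξ, Φ ξ * conj ξ *
        ∑' n, derivCoeff (radialMeasure ω) n * (z * conj ξ) ^ n ∂weightMeasure ω := by
      refine (hω.hasSum_deriv_bergmanProjection hΦ hz).unique ?_
      convert! hsum using 1
      ext n
      rw [projCoeff, derivCoeff]
      simp_rw [pow_succ', mul_assoc]
      push_cast
      ring
    have hbound : ‖deriv (bergmanProjection ω Φ) z‖ₑ ≤ S * ENNReal.ofReal (M / (1 - ‖z‖)) := by
      rw [hder]
      refine (enorm_integral_le_lintegral_enorm _).trans ?_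
      refine le_trans ?_ (mul_le_mul_right (hMb z hz) _)
      rw [← lintegral_const_mul' _ _ (by simp)]
      refine lintegral_mono_ae ?_
      filter_upwards [ae_weightMeasure_mem_ball ω] with ξ hξ
      rw [enorm_mul]
      gcongr
      rw [enorm_le_coe, ← NNReal.coe_le_coe, coe_nnnorm, norm_mul, RCLike.norm_conj]
      exact (mul_le_of_le_one_right (norm_nonneg _) (mem_ball_zero_iff.1 hξ).le).trans (hΦS ξ hξ)
    have hnn : 0 ≤ 1 - ‖z‖ ^ 2 := by nlinarith [norm_nonneg z]
    rw [ENNReal.ofReal_mul hnn, ofReal_norm]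
    calc ENNReal.ofReal (1 - ‖z‖ ^ 2) * ‖deriv (bergmanProjection ω Φ) z‖ₑ
        ≤ ENNReal.ofReal (1 - ‖z‖ ^ 2) * (S * ENNReal.ofReal (M / (1 - ‖z‖))) := by gcongr
      _ = ENNReal.ofReal ((1 - ‖z‖ ^ 2) * (M / (1 - ‖z‖))) * S := by
          rw [ENNReal.ofReal_mul hnn]; ring
      -- Here `1 - |z|² ≤ 2(1 - |z|)`.
      _ ≤ ENNReal.ofReal (2 * M) * S := by
          refine mul_le_mul_left (ENNReal.ofReal_le_ofReal ?_) _
          rw [mul_div_assoc', div_le_iff₀ h1z]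
          nlinarith [mul_nonneg hM.le (mul_nonneg h1z.le h1z.le)]
      _ = _ := rfl
  · have h0 : bergmanProjection ω Φ 0 = projCoeff ω Φ 0 := by
      refine (hω.eqOn_bergmanProjection hΦ (by simp)).trans ?_
      dsimp only
      rw [tsum_eq_single 0]
      · simp
      · intro n hn; simp [hn]
    rw [h0, ← ofReal_norm]
    have h1 : ‖projCoeff ω Φ 0‖ ≤ c₀ * S := by
      rw [projCoeff, norm_mul, hμ.norm_inv_moment, hc₀, mul_assoc]
      gcongr
      simp only [pow_zero, mul_one]
      rw [mul_comm]
      exact norm_integral_le_of_norm_le_const ((ae_weightMeasure_mem_ball ω).mono hΦS)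
    refine (ENNReal.ofReal_le_ofReal h1).trans ?_
    rw [ENNReal.ofReal_mul hc₀0, ENNReal.ofReal_coe_nnreal]
    exact le_rfl

end IsDoublingWeight

/-! ### Continuous symbols and the little Bloch condition -/

section DiskExtend

variable (Φ : C(closedBall (0 : ℂ) 1, ℂ))

lemma diskExtend_apply {z : ℂ} (hz : z ∈ closedBall (0 : ℂ) 1) : diskExtend Φ z = Φ ⟨z, hz⟩ :=
  Subtype.val_injective.extend_apply Φ 0 ⟨z, hz⟩

lemma continuousOn_diskExtend : ContinuousOn (diskExtend Φ) (closedBall 0 1) := by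
  rw [continuousOn_iff_continuous_domRestrict]
  convert Φ.continuous using 1
  ext z
  exact diskExtend_apply Φ z.2

lemma continuousOn_diskExtend_ball : ContinuousOn (diskExtend Φ) (ball 0 1) :=
  (continuousOn_diskExtend Φ).mono ball_subset_closedBall

lemma norm_diskExtend_le {z : ℂ} (hz : z ∈ ball (0 : ℂ) 1) : ‖diskExtend Φ z‖ ≤ ‖Φ‖₊ := by
  rw [diskExtend_apply Φ (ball_subset_closedBall hz)]
  exact Φ.norm_coe_le_norm _

end DiskExtend

lemma IsRadialWeight.integrable_diskExtend {ω : ℂ → ℝ} (hω : IsRadialWeight ω)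
    (Φ : C(closedBall (0 : ℂ) 1, ℂ)) : Integrable (diskExtend Φ) (weightMeasure ω) :=
  hω.integrable_of_continuousOn_of_bound (continuousOn_diskExtend_ball Φ) ‖Φ‖₊
    fun _ hz => norm_diskExtend_le Φ hz

namespace IsRadialWeight

variable {ω : ℂ → ℝ}

lemma projCoeff_add (hω : IsRadialWeight ω) (Φ Ψ : C(closedBall (0 : ℂ) 1, ℂ)) (n : ℕ) :
    projCoeff ω (diskExtend (Φ + Ψ)) n =
      projCoeff ω (diskExtend Φ) n + projCoeff ω (diskExtend Ψ) n := by
  rw [projCoeff, projCoeff, projCoeff, ← mul_add,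
    ← integral_add (integrable_mul_conj_pow (hω.integrable_diskExtend Φ) n)
      (integrable_mul_conj_pow (hω.integrable_diskExtend Ψ) n)]
  congr 1
  refine integral_congr_ae ?_
  filter_upwards [ae_weightMeasure_mem_ball ω] with ξ hξ
  have hξ' := ball_subset_closedBall hξ
  rw [diskExtend_apply _ hξ', diskExtend_apply _ hξ', diskExtend_apply _ hξ',
    ContinuousMap.add_apply, add_mul]

lemma projCoeff_smul (c : ℂ) (Φ : C(closedBall (0 : ℂ) 1, ℂ)) (n : ℕ) :
    projCoeff ω (diskExtend (c • Φ)) n = c * projCoeff ω (diskExtend Φ) n := by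
  rw [projCoeff, projCoeff, mul_left_comm]
  congr 1
  rw [← integral_const_mul]
  refine integral_congr_ae ?_
  filter_upwards [ae_weightMeasure_mem_ball ω] with ξ hξ
  have hξ' := ball_subset_closedBall hξ
  rw [diskExtend_apply _ hξ', diskExtend_apply _ hξ', ContinuousMap.smul_apply, smul_eq_mul,
    mul_assoc]

end IsRadialWeight

namespace IsDoublingWeight

variable {ω : ℂ → ℝ}

lemma deriv_bergmanProjection_add (hω : IsDoublingWeight ω) (Φ Ψ : C(closedBall (0 : ℂ) 1, ℂ))
    {z : ℂ} (hz : z ∈ ball (0 : ℂ) 1) :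
    deriv (bergmanProjection ω (diskExtend (Φ + Ψ))) z =
      deriv (bergmanProjection ω (diskExtend Φ)) z +
        deriv (bergmanProjection ω (diskExtend Ψ)) z := by
  have hR := hω.toIsRadialWeight
  refine (hω.hasSum_deriv_bergmanProjection (hR.integrable_diskExtend _) hz).unique ?_
  convert! (hω.hasSum_deriv_bergmanProjection (hR.integrable_diskExtend Φ) hz).add
    (hω.hasSum_deriv_bergmanProjection (hR.integrable_diskExtend Ψ) hz) using 1
  ext n
  rw [hR.projCoeff_add]; ring

lemma deriv_bergmanProjection_smul (hω : IsDoublingWeight ω) (c : ℂ)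
    (Φ : C(closedBall (0 : ℂ) 1, ℂ)) {z : ℂ} (hz : z ∈ ball (0 : ℂ) 1) :
    deriv (bergmanProjection ω (diskExtend (c • Φ))) z =
      c * deriv (bergmanProjection ω (diskExtend Φ)) z := by
  have hR := hω.toIsRadialWeight
  refine (hω.hasSum_deriv_bergmanProjection (hR.integrable_diskExtend _) hz).unique ?_
  convert! (hω.hasSum_deriv_bergmanProjection (hR.integrable_diskExtend Φ) hz).mul_left c using 1
  ext n
  rw [IsRadialWeight.projCoeff_smul]; ring

end IsDoublingWeight

lemma eventually_mem_ball_comap_norm :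
    ∀ᶠ z : ℂ in comap norm (𝓝[<] (1 : ℝ)), z ∈ ball (0 : ℂ) 1 := by
  have h : ∀ᶠ x in 𝓝[<] (1 : ℝ), x < 1 := self_mem_nhdsWithin
  filter_upwards [h.comap (norm : ℂ → ℝ)] with z hz
  simpa using hz

lemma tendsto_one_sub_norm_sq :
    Tendsto (fun z : ℂ => 1 - ‖z‖ ^ 2) (comap norm (𝓝[<] (1 : ℝ))) (𝓝 0) := by
  have h1 : Tendsto (norm : ℂ → ℝ) (comap norm (𝓝[<] (1 : ℝ))) (𝓝 1) :=
    tendsto_comap.mono_right nhdsWithin_le_nhds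
  simpa using (tendsto_const_nhds (x := (1 : ℝ))).sub (h1.pow 2)

lemma tendsto_one_sub_norm_sq_mul_of_bounded {g : ℂ → ℂ} (B : ℝ)
    (hB : ∀ z ∈ ball (0 : ℂ) 1, ‖g z‖ ≤ B) :
    Tendsto (fun z : ℂ => (1 - ‖z‖ ^ 2) * ‖g z‖) (comap norm (𝓝[<] (1 : ℝ))) (𝓝 0) := by
  have h := tendsto_one_sub_norm_sq.mul_const B
  rw [zero_mul] at h
  refine squeeze_zero' ?_ ?_ h <;>
    filter_upwards [eventually_mem_ball_comap_norm] with z hz <;>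
    have hz1 : ‖z‖ < 1 := mem_ball_zero_iff.1 hz <;>
    have hnn : 0 ≤ 1 - ‖z‖ ^ 2 := by nlinarith [norm_nonneg z]
  · positivity
  · exact mul_le_mul_of_nonneg_left (hB z hz) hnn

/-- The coordinate function on the closed disk. -/
def diskCoord : C(closedBall (0 : ℂ) 1, ℂ) := ContinuousMap.restrict _ (.id ℂ)

/-- Stone–Weierstrass: the star algebra generated by the coordinate is dense, and it is spanned by
the products of powers of the coordinate and its conjugate. -/
lemma dense_span_monomials :
    (Submodule.span ℂ
      {Φ : C(closedBall (0 : ℂ) 1, ℂ) | ∃ a b : ℕ, diskCoord ^ a * star diskCoord ^ b = Φ}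
      ).topologicalClosure = ⊤ := by
  have h1 := ContinuousMap.elemental_id_eq_top (𝕜 := ℂ) (closedBall (0 : ℂ) 1)
  have h2 : Submodule.span ℂ
      {Φ : C(closedBall (0 : ℂ) 1, ℂ) | ∃ a b : ℕ, diskCoord ^ a * star diskCoord ^ b = Φ} =
      Subalgebra.toSubmodule (StarAlgebra.adjoin ℂ {diskCoord}).toSubalgebra := by
    rw [StarAlgebra.adjoin_toSubalgebra, Algebra.adjoin_eq_span]
    congr 1
    ext Φ
    rw [star_singleton, singleton_union, SetLike.mem_coe, Submonoid.mem_closure_pair]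
    rfl
  rw [h2]
  refine SetLike.ext fun Φ => iff_of_true ?_ trivial
  have h3 : Φ ∈ StarAlgebra.elemental ℂ (ContinuousMap.restrict (closedBall (0 : ℂ) 1) (.id ℂ)) := by
    rw [h1]; trivial
  exact h3

namespace IsDoublingWeight

variable {ω : ℂ → ℝ}

/-- The angular integral of `ξ^a conj(ξ)^(b+n)` vanishes unless `a = b + n`. -/
lemma projCoeff_monomial_eq_zero (hω : IsDoublingWeight ω) (a b : ℕ) {n : ℕ} (hn : a < n) :
    projCoeff ω (diskExtend (diskCoord ^ a * star diskCoord ^ b)) n = 0 := by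
  have hR := hω.toIsRadialWeight
  rw [projCoeff, hR.integral_weightMeasure_polar
    (integrable_mul_conj_pow (hR.integrable_diskExtend _) n)]
  refine mul_eq_zero_of_right _ ?_
  refine integral_eq_zero_of_ae ?_
  filter_upwards [ae_radialMeasure_mem ω] with t ht
  have h : ∀ θ, diskExtend (diskCoord ^ a * star diskCoord ^ b) (polarPoint t θ) *
      conj (polarPoint t θ) ^ n = polarPoint t θ ^ a * conj (polarPoint t θ) ^ (b + n) := by
    intro θ
    rw [diskExtend_apply _ (by simpa [abs_of_pos ht.1] using ht.2.le), pow_add, ← mul_assoc]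
    rfl
  simp_rw [h]
  rw [integral_angleMeasure_monomial, if_neg (by omega)]
  rfl

/-- The projection is a polynomial of degree at most `a`, so its derivative is bounded on the disk.
-/
lemma tendsto_deriv_bergmanProjection_monomial (hω : IsDoublingWeight ω) (a b : ℕ) :
    Tendsto (fun z : ℂ => (1 - ‖z‖ ^ 2) * ‖deriv (bergmanProjection ω
      (diskExtend (diskCoord ^ a * star diskCoord ^ b))) z‖) (comap norm (𝓝[<] (1 : ℝ))) (𝓝 0) := by
  have hR := hω.toIsRadialWeight
  refine tendsto_one_sub_norm_sq_mul_of_bounded (∑ n ∈ Finset.range a, (n + 1) *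
    ‖projCoeff ω (diskExtend (diskCoord ^ a * star diskCoord ^ b)) (n + 1)‖) fun z hz => ?_
  have h1 := (hω.hasSum_deriv_bergmanProjection (hR.integrable_diskExtend
    (diskCoord ^ a * star diskCoord ^ b)) hz).unique
    (hasSum_sum_of_ne_finset_zero (s := Finset.range a) fun n hn => by
      rw [hω.projCoeff_monomial_eq_zero a b (by simpa [Nat.lt_succ_iff] using hn)]; simp)
  rw [h1]
  refine (norm_sum_le _ _).trans (Finset.sum_le_sum fun n _ => ?_)
  rw [norm_mul, norm_mul, norm_pow]
  refine (mul_le_of_le_one_right (by positivity)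
    (pow_le_one₀ (norm_nonneg _) (mem_ball_zero_iff.1 hz).le)).trans (le_of_eq ?_)
  congr 1
  exact_mod_cast Complex.norm_natCast (n + 1)

/-- The Bergman projection maps continuous functions into the little Bloch space. -/
theorem tendsto_deriv_bergmanProjection (hω : IsDoublingWeight ω)
    (Φ : C(closedBall (0 : ℂ) 1, ℂ)) :
    Tendsto (fun z : ℂ => (1 - ‖z‖ ^ 2) * ‖deriv (bergmanProjection ω (diskExtend Φ)) z‖)
      (comap norm (𝓝[<] (1 : ℝ))) (𝓝 0) := by
  obtain ⟨M, hM⟩ := hω.exists_blochNorm_bergmanProjection_le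
  have hbound : ∀ (Ψ : C(closedBall (0 : ℂ) 1, ℂ)), ∀ z ∈ ball (0 : ℂ) 1,
      (1 - ‖z‖ ^ 2) * ‖deriv (bergmanProjection ω (diskExtend Ψ)) z‖ ≤ M * ‖Ψ‖ := by
    intro Ψ z hz
    have h1 := hM (diskExtend Ψ) ‖Ψ‖₊ (continuousOn_diskExtend_ball Ψ)
      fun w hw => norm_diskExtend_le Ψ hw
    have h2 : ENNReal.ofReal ((1 - ‖z‖ ^ 2) *
        ‖deriv (bergmanProjection ω (diskExtend Ψ)) z‖) ≤ M * ‖Ψ‖₊ :=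
      (le_trans (le_iSup₂ (f := fun z (_ : z ∈ ball (0 : ℂ) 1) => ENNReal.ofReal
        ((1 - ‖z‖ ^ 2) * ‖deriv (bergmanProjection ω (diskExtend Ψ)) z‖)) z hz)
        le_self_add).trans h1
    rw [← ENNReal.coe_mul] at h2
    simpa using ENNReal.ofReal_le_coe.1 h2
  have hadd : ∀ Ψ₁ Ψ₂ : C(closedBall (0 : ℂ) 1, ℂ), ∀ z ∈ ball (0 : ℂ) 1,
      (1 - ‖z‖ ^ 2) * ‖deriv (bergmanProjection ω (diskExtend (Ψ₁ + Ψ₂))) z‖ ≤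
      (1 - ‖z‖ ^ 2) * ‖deriv (bergmanProjection ω (diskExtend Ψ₁)) z‖ +
      (1 - ‖z‖ ^ 2) * ‖deriv (bergmanProjection ω (diskExtend Ψ₂)) z‖ := by
    intro Ψ₁ Ψ₂ z hz
    have hz1 : ‖z‖ < 1 := mem_ball_zero_iff.1 hz
    rw [hω.deriv_bergmanProjection_add _ _ hz, ← mul_add]
    exact mul_le_mul_of_nonneg_left (norm_add_le _ _) (by nlinarith [norm_nonneg z])
  have hnn : ∀ Ψ : C(closedBall (0 : ℂ) 1, ℂ), ∀ᶠ z : ℂ in comap norm (𝓝[<] (1 : ℝ)),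
      0 ≤ (1 - ‖z‖ ^ 2) * ‖deriv (bergmanProjection ω (diskExtend Ψ)) z‖ := by
    intro Ψ
    filter_upwards [eventually_mem_ball_comap_norm] with z hz
    have hz1 : ‖z‖ < 1 := mem_ball_zero_iff.1 hz
    exact mul_nonneg (by nlinarith [norm_nonneg z]) (norm_nonneg _)
  have hspan : ∀ Ψ ∈ Submodule.span ℂ
      {Φ : C(closedBall (0 : ℂ) 1, ℂ) | ∃ a b : ℕ, diskCoord ^ a * star diskCoord ^ b = Φ},
      Tendsto (fun z : ℂ => (1 - ‖z‖ ^ 2) * ‖deriv (bergmanProjection ω (diskExtend Ψ)) z‖)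
        (comap norm (𝓝[<] (1 : ℝ))) (𝓝 0) := by
    intro Ψ hΨ
    induction hΨ using Submodule.span_induction with
    | mem x hx =>
      obtain ⟨a, b, rfl⟩ := hx
      exact hω.tendsto_deriv_bergmanProjection_monomial a b
    | zero =>
      refine squeeze_zero' (hnn 0) ?_ (tendsto_const_nhds (x := (0 : ℝ)))
      filter_upwards [eventually_mem_ball_comap_norm] with z hz
      simpa using hbound 0 z hz
    | add x y _ _ hx hy =>
      have h := hx.add hy
      rw [add_zero] at h
      refine squeeze_zero' (hnn _) ?_ h
      filter_upwards [eventually_mem_ball_comap_norm] with z hz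
      exact hadd x y z hz
    | smul c x _ hx =>
      have h := hx.const_mul ‖c‖
      rw [mul_zero] at h
      refine h.congr' ?_
      filter_upwards [eventually_mem_ball_comap_norm] with z hz
      rw [hω.deriv_bergmanProjection_smul c x hz, norm_mul]; ring
  rw [Metric.tendsto_nhds]
  intro ε hε
  have hΦ : Φ ∈ closure (Submodule.span ℂ {Φ : C(closedBall (0 : ℂ) 1, ℂ) |
      ∃ a b : ℕ, diskCoord ^ a * star diskCoord ^ b = Φ} : Set C(closedBall (0 : ℂ) 1, ℂ)) := by
    rw [← Submodule.topologicalClosure_coe, dense_span_monomials]; trivial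
  -- The approximation error then contributes at most `ε/2` to the Bloch seminorm; `M + 1` guards
  -- against `M = 0`.
  have hδ : 0 < ε / 2 / (M + 1) := by positivity
  obtain ⟨Ψ, hΨ, hd⟩ := Metric.mem_closure_iff.1 hΦ _ hδ
  have h1 := (hspan Ψ hΨ).eventually_lt_const (show (0 : ℝ) < ε / 2 by positivity)
  filter_upwards [h1, hnn Φ, eventually_mem_ball_comap_norm] with z hz1 hz2 hz3
  rw [Real.dist_eq, sub_zero, abs_of_nonneg hz2]
  have h2 := hadd (Φ - Ψ) Ψ z hz3
  rw [sub_add_cancel] at h2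
  have h3 := hbound (Φ - Ψ) z hz3
  rw [dist_eq_norm] at hd
  have h4 : (M : ℝ) * ‖Φ - Ψ‖ ≤ ε / 2 := by
    calc (M : ℝ) * ‖Φ - Ψ‖ ≤ (M + 1) * (ε / 2 / (M + 1)) := by gcongr; simp
      _ = ε / 2 := by field_simp
  linarith

end IsDoublingWeight

/-! ### Surjectivity: an explicit right inverse of the projection -/

/-- The ratio of the tail mass at `s` to the mass of `(s, 1 - (1 - s) / K]`. -/
def sweepRatio (μ : Measure ℝ) (K s : ℝ) : ℝ := tail μ s / (tail μ s - tail μ (1 - (1 - s) / K))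

/-- The kernel that moves the mass `T(s) ds` to the measure `μ` on `(s, 1 - (1 - s) / K]`. -/
def sweepKernel (μ : Measure ℝ) (K t s : ℝ) : ℝ :=
  if 1 - s ≤ K * (1 - t) then sweepRatio μ K s else 0

/-- The multiplier by which `sweep` acts on the monomial of degree `k + 1`. -/
def sweepMultiplier (μ : Measure ℝ) (K : ℝ) (k : ℕ) (t : ℝ) : ℝ :=
  ∫ x in Ioo (0 : ℝ) 1, (2 * k + 2) * (sweepKernel μ K t (x * t) * x ^ (2 * k + 1))

/-- A right inverse of the Bergman projection, up to the constant term, in terms of the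
derivative `g` of the given function. -/
def sweep (μ : Measure ℝ) (K : ℝ) (g : ℂ → ℂ) (ξ : ℂ) : ℂ :=
  2 * ξ * ∫ x in Ioo (0 : ℝ) 1, ((sweepKernel μ K ‖ξ‖ (x * ‖ξ‖) * x : ℝ) : ℂ) * g ((x : ℂ) ^ 2 * ξ)

namespace IsDoublingMeasure

variable {μ : Measure ℝ} {K : ℝ}

lemma sweep_denom_pos (hμ : IsDoublingMeasure μ)
    (hK : ∀ r ∈ Ico (0 : ℝ) 1, 2 * tail μ (1 - (1 - r) / K) ≤ tail μ r) {s : ℝ}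
    (hs : s ∈ Ico (0 : ℝ) 1) : 0 < tail μ s - tail μ (1 - (1 - s) / K) := by
  have := hμ.tail_pos s hs.2
  have := hK s hs
  linarith

/-- The lower condition says that at least half of the mass beyond `s` lies in `(s, 1-(1-s)/K]`,
whence the bound 2. -/
lemma sweepRatio_mem (hμ : IsDoublingMeasure μ)
    (hK : ∀ r ∈ Ico (0 : ℝ) 1, 2 * tail μ (1 - (1 - r) / K) ≤ tail μ r) {s : ℝ}
    (hs : s ∈ Ico (0 : ℝ) 1) : sweepRatio μ K s ∈ Icc (0 : ℝ) 2 := by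
  have h1 := hμ.tail_pos s hs.2
  have h2 := hK s hs
  have h3 := hμ.sweep_denom_pos hK hs
  refine ⟨div_nonneg h1.le h3.le, ?_⟩
  rw [sweepRatio, div_le_iff₀ h3]
  linarith

lemma sweepKernel_mem (hμ : IsDoublingMeasure μ)
    (hK : ∀ r ∈ Ico (0 : ℝ) 1, 2 * tail μ (1 - (1 - r) / K) ≤ tail μ r) {s : ℝ}
    (hs : s ∈ Ico (0 : ℝ) 1) (t : ℝ) : sweepKernel μ K t s ∈ Icc (0 : ℝ) 2 := by
  rw [sweepKernel]
  split_ifs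
  · exact hμ.sweepRatio_mem hK hs
  · simp

lemma continuousAt_sweepRatio (hμ : IsDoublingMeasure μ)
    (hK : ∀ r ∈ Ico (0 : ℝ) 1, 2 * tail μ (1 - (1 - r) / K) ≤ tail μ r) {s : ℝ}
    (hs : s ∈ Ico (0 : ℝ) 1) : ContinuousAt (sweepRatio μ K) s := by
  have hc := hμ.continuous_tail
  refine ContinuousAt.div hc.continuousAt ?_ (hμ.sweep_denom_pos hK hs).ne'
  exact (hc.sub (hc.comp (by fun_prop))).continuousAt

lemma measurable_sweepKernel (hμ : IsDoublingMeasure μ) (K : ℝ) :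
    Measurable fun p : ℝ × ℝ => sweepKernel μ K p.1 p.2 := by
  have hc := hμ.continuous_tail
  have hr : Measurable (sweepRatio μ K) :=
    hc.measurable.div (hc.sub (hc.comp (by fun_prop))).measurable
  refine Measurable.ite ?_ (hr.comp measurable_snd) measurable_const
  exact measurableSet_le (by fun_prop) (by fun_prop)

lemma mul_mem_Ico {x t : ℝ} (hx : x ∈ Ioo (0 : ℝ) 1) (ht : t ∈ Ico (0 : ℝ) 1) :
    x * t ∈ Ico (0 : ℝ) 1 :=
  ⟨mul_nonneg hx.1.le ht.1, by nlinarith [hx.1, hx.2, ht.1, ht.2]⟩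

lemma moment_eq_integral (hμ : IsDoublingMeasure μ) (k : ℕ) :
    moment μ (k + 1) = ∫ s in Ioo (0 : ℝ) 1, tail μ s * ((2 * k + 2) * s ^ (2 * k + 1)) := by
  rw [integral_eq_lintegral_of_nonneg_ae, ← hμ.ofReal_moment_eq,
    ENNReal.toReal_ofReal (hμ.moment_pos _).le]
  · filter_upwards [ae_restrict_mem measurableSet_Ioo] with s hs
    have := tail_nonneg μ s
    have := hs.1
    simp only [Pi.zero_apply]
    positivity
  · have hc := hμ.continuous_tail
    exact (by fun_prop : Continuous fun s => tail μ s * ((2 * k + 2) * s ^ (2 * k + 1))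
      ).aestronglyMeasurable

/-- For fixed `s` the kernel is constant on `(s, 1-(1-s)/K]`, with value `T(s)` divided by the
`μ`-mass of that interval. -/
lemma integral_sweepKernel (hμ : IsDoublingMeasure μ) (hK1 : 1 < K)
    (hK : ∀ r ∈ Ico (0 : ℝ) 1, 2 * tail μ (1 - (1 - r) / K) ≤ tail μ r) {s : ℝ}
    (hs : s ∈ Ioo (0 : ℝ) 1) :
    ∫ t, (if s < t then sweepKernel μ K t s else 0) ∂μ = tail μ s := by
  have := hμ.finite
  have hK0 : 0 < K := by linarith
  have hsI : s ∈ Ico (0 : ℝ) 1 := ⟨hs.1.le, hs.2⟩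
  have h1 : ∀ t, (if s < t then sweepKernel μ K t s else 0) =
      (Ioc s (1 - (1 - s) / K)).indicator (fun _ => sweepRatio μ K s) t := by
    intro t
    have h2 : 1 - s ≤ K * (1 - t) ↔ t ≤ 1 - (1 - s) / K := by
      rw [le_sub_comm, div_le_iff₀ hK0, mul_comm]
    by_cases h3 : s < t <;> by_cases h4 : t ≤ 1 - (1 - s) / K <;>
      simp [sweepKernel, indicator, h2, h3, h4]
  simp_rw [h1]
  have hle : s ≤ 1 - (1 - s) / K := by
    have : (1 - s) / K ≤ 1 - s := div_le_self (by linarith [hs.2]) hK1.le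
    linarith
  have h5 : μ.real (Ioc s (1 - (1 - s) / K)) = tail μ s - tail μ (1 - (1 - s) / K) := by
    rw [← Ioi_sdiff_Ioi, measureReal_sdiff (Ioi_subset_Ioi hle) measurableSet_Ioi]
    rfl
  rw [integral_indicator_const _ measurableSet_Ioc, h5, smul_eq_mul, sweepRatio,
    mul_div_cancel₀]
  exact (hμ.sweep_denom_pos hK hsI).ne'

/-- The substitution `s = xt` turns the scaled integral over `(0,1)` into one over `(0,t)`, in the
form suited to Fubini. -/
lemma sweepMultiplier_mul_pow (k : ℕ) {t : ℝ} (ht : t ∈ Ioo (0 : ℝ) 1) :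
    sweepMultiplier μ K k t * t ^ (2 * (k + 1)) =
      ∫ s in Ioo (0 : ℝ) 1,
        (if s < t then sweepKernel μ K t s else 0) * ((2 * k + 2) * s ^ (2 * k + 1)) := by
  have ht0 := ht.1
  set f : ℝ → ℝ := fun s => sweepKernel μ K t s * ((2 * k + 2) * s ^ (2 * k + 1)) with hf
  have h1 : sweepMultiplier μ K k t * t ^ (2 * (k + 1)) = t * ∫ x in (0 : ℝ)..1, f (x * t) := by
    rw [sweepMultiplier, ← integral_Ioc_eq_integral_Ioo,
      ← intervalIntegral.integral_of_le zero_le_one, ← intervalIntegral.integral_mul_const,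
      ← intervalIntegral.integral_const_mul]
    congr 1
    ext x
    simp only [hf]
    ring
  rw [h1, intervalIntegral.integral_comp_mul_right _ ht0.ne', zero_mul, one_mul, smul_eq_mul,
    ← mul_assoc, mul_inv_cancel₀ ht0.ne', one_mul, intervalIntegral.integral_of_le ht0.le,
    integral_Ioc_eq_integral_Ioo]
  have h2 : ∀ s, (if s < t then sweepKernel μ K t s else 0) * ((2 * k + 2) * s ^ (2 * k + 1)) =
      (Iio t).indicator f s := by
    intro s
    by_cases h : s < t <;> simp [h, hf, indicator]
  simp_rw [h2]
  rw [setIntegral_indicator measurableSet_Iio, Ioo_inter_Iio, min_eq_right ht.2.le]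

/-- Fubini: integrating first in `t` restores `T(s)`, and the layer cake formula for the moment
finishes. This identity is what makes `sweep` a right inverse on nonconstant terms. -/
lemma integral_sweepMultiplier (hμ : IsDoublingMeasure μ) (hK1 : 1 < K)
    (hK : ∀ r ∈ Ico (0 : ℝ) 1, 2 * tail μ (1 - (1 - r) / K) ≤ tail μ r) (k : ℕ) :
    ∫ t, sweepMultiplier μ K k t * t ^ (2 * (k + 1)) ∂μ = moment μ (k + 1) := by
  have := hμ.finite
  have h1 : ∫ t, sweepMultiplier μ K k t * t ^ (2 * (k + 1)) ∂μ =
      ∫ t, (∫ s in Ioo (0 : ℝ) 1,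
        (if s < t then sweepKernel μ K t s else 0) * ((2 * k + 2) * s ^ (2 * k + 1))) ∂μ :=
    integral_congr_ae (hμ.ae_mem.mono fun t ht => sweepMultiplier_mul_pow k ht)
  have hmeas : Measurable fun p : ℝ × ℝ => (if p.2 < p.1 then sweepKernel μ K p.1 p.2 else 0) *
      ((2 * k + 2) * p.2 ^ (2 * k + 1)) := by
    refine Measurable.mul ?_ (by fun_prop)
    exact Measurable.ite (measurableSet_lt (by fun_prop) (by fun_prop))
      (hμ.measurable_sweepKernel K) measurable_const
  rw [h1, integral_integral_swap, hμ.moment_eq_integral]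
  · refine setIntegral_congr_fun measurableSet_Ioo fun s hs => ?_
    rw [integral_mul_const, hμ.integral_sweepKernel hK1 hK hs]
  · refine Integrable.of_bound (C := 2 * (2 * k + 2)) hmeas.aestronglyMeasurable ?_
    have h2 : ∀ᵐ p ∂(μ.prod (volume.restrict (Ioo (0 : ℝ) 1))), p.2 ∈ Ioo (0 : ℝ) 1 :=
      Measure.quasiMeasurePreserving_snd.ae (ae_restrict_mem measurableSet_Ioo)
    filter_upwards [h2] with p hp
    have h3 := hμ.sweepKernel_mem hK ⟨hp.1.le, hp.2⟩ p.1
    have h4 : (if p.2 < p.1 then sweepKernel μ K p.1 p.2 else 0) ∈ Icc (0 : ℝ) 2 := by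
      split_ifs
      · exact h3
      · simp
    have h5 : p.2 ^ (2 * k + 1) ≤ 1 := pow_le_one₀ hp.1.le hp.2.le
    have h6 : 0 ≤ p.2 ^ (2 * k + 1) := pow_nonneg hp.1.le _
    simp only [Function.uncurry]
    rw [Real.norm_of_nonneg (mul_nonneg h4.1 (by positivity))]
    refine mul_le_mul h4.2 ?_ (by positivity) (by norm_num)
    exact mul_le_of_le_one_right (by positivity) h5

lemma abs_sweepMultiplier_le (hμ : IsDoublingMeasure μ)
    (hK : ∀ r ∈ Ico (0 : ℝ) 1, 2 * tail μ (1 - (1 - r) / K) ≤ tail μ r) (k : ℕ) {t : ℝ}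
    (ht : t ∈ Ico (0 : ℝ) 1) : |sweepMultiplier μ K k t| ≤ 4 * (k + 1) := by
  have h := norm_setIntegral_le_of_norm_le_const (μ := volume) (s := Ioo (0 : ℝ) 1)
    (C := 4 * (k + 1)) (f := fun x => (2 * k + 2) *
      (sweepKernel μ K t (x * t) * x ^ (2 * k + 1))) (by simp) fun x hx => ?_
  · simpa [sweepMultiplier] using h
  · have h1 := hμ.sweepKernel_mem hK (mul_mem_Ico hx ht) t
    have h2 : x ^ (2 * k + 1) ≤ 1 := pow_le_one₀ hx.1.le hx.2.le
    have h3 : 0 ≤ x ^ (2 * k + 1) := pow_nonneg hx.1.le _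
    rw [Real.norm_of_nonneg (mul_nonneg (by positivity) (mul_nonneg h1.1 h3))]
    have h4 : sweepKernel μ K t (x * t) * x ^ (2 * k + 1) ≤ 2 * 1 :=
      mul_le_mul h1.2 h2 h3 (by norm_num)
    nlinarith

lemma measurable_sweepKernel_mul (hμ : IsDoublingMeasure μ) (K t : ℝ) :
    Measurable fun x => sweepKernel μ K t (x * t) :=
  (hμ.measurable_sweepKernel K).comp (by fun_prop : Measurable fun x : ℝ => (t, x * t))

/-- The Taylor series of `h'` is integrated term by term in `x`. The factor `2ξ` and the coefficient
`(k+1)h_(k+1)` of `h'` combine to the weight `2k+2` of the multiplier. -/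
lemma hasSum_sweep (hμ : IsDoublingMeasure μ)
    (hK : ∀ r ∈ Ico (0 : ℝ) 1, 2 * tail μ (1 - (1 - r) / K) ≤ tail μ r) {h : ℂ → ℂ}
    (hd : DifferentiableOn ℂ h (ball 0 1)) {ξ : ℂ} (hξ : ξ ∈ ball (0 : ℂ) 1) :
    HasSum (fun k => taylorCoeff h (k + 1) * sweepMultiplier μ K k ‖ξ‖ * ξ ^ (k + 1))
      (sweep μ K (deriv h) ξ) := by
  have hξ1 : ‖ξ‖ ∈ Ico (0 : ℝ) 1 := ⟨norm_nonneg _, mem_ball_zero_iff.1 hξ⟩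
  have hd' : DifferentiableOn ℂ (deriv h) (ball 0 1) := hd.deriv isOpen_ball
  set F : ℕ → ℝ → ℂ := fun k x => ((sweepKernel μ K ‖ξ‖ (x * ‖ξ‖) * x : ℝ) : ℂ) *
    (taylorCoeff (deriv h) k * ((x : ℂ) ^ 2 * ξ) ^ k) with hF
  have hb : ∀ k, ∀ x ∈ Ioo (0 : ℝ) 1, ‖F k x‖ ≤ 2 * (‖taylorCoeff (deriv h) k‖ * ‖ξ‖ ^ k) := by
    intro k x hx
    have h1 := hμ.sweepKernel_mem hK (mul_mem_Ico hx hξ1) ‖ξ‖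
    have h2 : sweepKernel μ K ‖ξ‖ (x * ‖ξ‖) * x ≤ 2 * 1 :=
      mul_le_mul h1.2 hx.2.le hx.1.le (by norm_num)
    have h3 : (x ^ 2 * ‖ξ‖) ^ k ≤ ‖ξ‖ ^ k := by
      have hx0 := hx.1
      refine pow_le_pow_left₀ (by positivity) ?_ k
      exact mul_le_of_le_one_left (norm_nonneg _) (pow_le_one₀ hx.1.le hx.2.le)
    simp only [hF]
    rw [norm_mul, norm_mul, norm_pow, norm_mul, norm_pow, Complex.norm_real, Complex.norm_real,
      Real.norm_of_nonneg (mul_nonneg h1.1 hx.1.le), Real.norm_of_nonneg hx.1.le]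
    have hx0 := hx.1
    refine mul_le_mul (by linarith) ?_ (by positivity) (by norm_num)
    gcongr
  have hm : ∀ k, AEStronglyMeasurable (F k) (volume.restrict (Ioo (0 : ℝ) 1)) := by
    intro k
    have h1 := hμ.measurable_sweepKernel_mul K ‖ξ‖
    refine Measurable.aestronglyMeasurable ?_
    exact (Complex.measurable_ofReal.comp (h1.mul measurable_id)).mul
      (by fun_prop : Continuous fun x : ℝ =>
        taylorCoeff (deriv h) k * ((x : ℂ) ^ 2 * ξ) ^ k).measurable
  have hi : ∀ k, Integrable (F k) (volume.restrict (Ioo (0 : ℝ) 1)) := fun k =>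
    Integrable.of_bound (hm k) _ ((ae_restrict_mem measurableSet_Ioo).mono (hb k))
  have hsumm := (summable_norm_taylorCoeff hd' hξ1).mul_left 2
  have hS := hasSum_integral_of_summable_integral_norm hi (by
    refine Summable.of_nonneg_of_le (fun k => integral_nonneg fun _ => norm_nonneg _)
      (fun k => ?_) hsumm
    have h1 : ∫ x in Ioo (0 : ℝ) 1, ‖F k x‖ ≤
        ∫ x in Ioo (0 : ℝ) 1, 2 * (‖taylorCoeff (deriv h) k‖ * ‖ξ‖ ^ k) :=
      setIntegral_mono_on (hi k).norm (integrable_const _) measurableSet_Ioo (hb k)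
    simpa using h1)
  have hS' := hS.mul_left (2 * ξ)
  convert! hS' using 1
  · ext k
    rw [sweepMultiplier, ← integral_complex_ofReal, ← integral_const_mul, ← integral_const_mul,
      ← integral_mul_const]
    congr 1
    ext x
    simp only [hF]
    rw [taylorCoeff_deriv]
    push_cast
    ring
  · rw [sweep]
    congr 1
    refine setIntegral_congr_fun measurableSet_Ioo fun x hx => ?_
    simp only [hF]
    rw [tsum_mul_left, (hasSum_taylorCoeff hd' (z := (x : ℂ) ^ 2 * ξ) ?_).tsum_eq]
    rw [mem_ball_zero_iff, norm_mul, norm_pow, Complex.norm_real, Real.norm_of_nonneg hx.1.le]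
    have : x ^ 2 ≤ 1 := pow_le_one₀ hx.1.le hx.2.le
    exact (mul_le_of_le_one_left (norm_nonneg _) this).trans_lt hξ1.2

/-- Dominated convergence. The cutoff in the kernel is discontinuous only where `1 - x|ξ| =
K(1-|ξ|)`: a single `x` if `ξ ≠ 0`, and none if `ξ = 0` because `K > 1`. -/
lemma continuousAt_sweep (hμ : IsDoublingMeasure μ) (hK1 : 1 < K)
    (hK : ∀ r ∈ Ico (0 : ℝ) 1, 2 * tail μ (1 - (1 - r) / K) ≤ tail μ r) {g : ℂ → ℂ}
    (hg : ContinuousOn g (ball 0 1)) {ξ : ℂ} (hξ : ξ ∈ ball (0 : ℂ) 1) :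
    ContinuousAt (sweep μ K g) ξ := by
  have hξ1 : ‖ξ‖ < 1 := mem_ball_zero_iff.1 hξ
  obtain ⟨R, hR1, hR2⟩ := exists_between hξ1
  have hR0 : 0 ≤ R := (norm_nonneg _).trans hR1.le
  have hsub : closedBall (0 : ℂ) R ⊆ ball 0 1 := closedBall_subset_ball hR2
  obtain ⟨B, hB⟩ := (isCompact_closedBall (0 : ℂ) R).exists_bound_of_continuousOn (hg.mono hsub)
  have hnhds : ∀ᶠ η in 𝓝 ξ, ‖η‖ < R := continuous_norm.continuousAt.eventually_lt_const hR1
  have hmem : ∀ {η : ℂ} {x : ℝ}, ‖η‖ < R → x ∈ Ioo (0 : ℝ) 1 →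
      (x : ℂ) ^ 2 * η ∈ closedBall (0 : ℂ) R := by
    intro η x hη hx
    rw [mem_closedBall_zero_iff, norm_mul, norm_pow, Complex.norm_real,
      Real.norm_of_nonneg hx.1.le]
    exact (mul_le_of_le_one_left (norm_nonneg _) (pow_le_one₀ hx.1.le hx.2.le)).trans hη.le
  refine ContinuousAt.mul (by fun_prop) ?_
  refine continuousAt_of_dominated (bound := fun _ => 2 * B) ?_ ?_ (integrable_const _) ?_
  · filter_upwards [hnhds] with η hη
    refine AEStronglyMeasurable.mul ?_ ?_
    · exact (Complex.measurable_ofReal.comp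
        ((hμ.measurable_sweepKernel_mul K ‖η‖).mul measurable_id)).aestronglyMeasurable
    · refine ContinuousOn.aestronglyMeasurable ?_ measurableSet_Ioo
      exact hg.comp (by fun_prop) fun x hx => hsub (hmem hη hx)
  · filter_upwards [hnhds] with η hη
    filter_upwards [ae_restrict_mem measurableSet_Ioo] with x hx
    have h1 := hμ.sweepKernel_mem hK
      (mul_mem_Ico hx ⟨norm_nonneg η, hη.trans hR2⟩) ‖η‖
    rw [norm_mul, Complex.norm_real, Real.norm_of_nonneg (mul_nonneg h1.1 hx.1.le)]
    have h2 : sweepKernel μ K ‖η‖ (x * ‖η‖) * x ≤ 2 * 1 :=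
      mul_le_mul h1.2 hx.2.le hx.1.le (by norm_num)
    exact mul_le_mul (by linarith) (hB _ (hmem hη hx)) (norm_nonneg _) (by norm_num)
  · have hne : ∀ᵐ x ∂volume.restrict (Ioo (0 : ℝ) 1), 1 - x * ‖ξ‖ ≠ K * (1 - ‖ξ‖) := by
      refine ae_restrict_of_ae ?_
      rcases eq_or_ne ‖ξ‖ 0 with h0 | h0
      · refine Eventually.of_forall fun x => ?_
        rw [h0]; intro h; linarith
      · have h1 : ∀ᵐ x ∂(volume : Measure ℝ), x ≠ (1 - K * (1 - ‖ξ‖)) / ‖ξ‖ := by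
          rw [ae_iff]; simp
        filter_upwards [h1] with x hx h
        apply hx
        rw [eq_div_iff h0]
        linarith
    filter_upwards [hne, ae_restrict_mem measurableSet_Ioo] with x hx hxI
    refine ContinuousAt.mul ?_ ?_
    · refine Complex.continuous_ofReal.continuousAt.comp (ContinuousAt.mul ?_ continuousAt_const)
      have hcont : ContinuousAt (fun η : ℂ => sweepRatio μ K (x * ‖η‖)) ξ :=
        ContinuousAt.comp (f := fun η : ℂ => x * ‖η‖)
          (hμ.continuousAt_sweepRatio hK (mul_mem_Ico hxI ⟨norm_nonneg ξ, hξ1⟩)) (by fun_prop)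
      have hl : ContinuousAt (fun η : ℂ => 1 - x * ‖η‖) ξ := by fun_prop
      have hr : ContinuousAt (fun η : ℂ => K * (1 - ‖η‖)) ξ := by fun_prop
      rcases lt_or_gt_of_ne hx with h | h
      · refine hcont.congr ?_
        filter_upwards [hl.eventually_lt hr h] with η hη
        rw [sweepKernel, if_pos hη.le]
      · refine (continuousAt_const (y := (0 : ℝ))).congr ?_
        filter_upwards [hr.eventually_lt hl h] with η hη
        rw [sweepKernel, if_neg (not_le.2 hη)]
    · refine ContinuousAt.comp (f := fun η : ℂ => (x : ℂ) ^ 2 * η)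
        (hg.continuousAt (isOpen_ball.mem_nhds (hsub (hmem hR1 hxI)))) (by fun_prop)

/-- Boundary behaviour of `sweep` for a function satisfying the little Bloch condition. -/
lemma norm_sweep_le (hμ : IsDoublingMeasure μ) (hK1 : 1 < K)
    (hK : ∀ r ∈ Ico (0 : ℝ) 1, 2 * tail μ (1 - (1 - r) / K) ≤ tail μ r) {g : ℂ → ℂ} {R ε : ℝ}
    (hg : ∀ z : ℂ, R < ‖z‖ → ‖z‖ < 1 → (1 - ‖z‖ ^ 2) * ‖g z‖ ≤ ε) {ξ : ℂ}
    (hξ1 : ‖ξ‖ < 1) (hpos : 0 ≤ 1 - K * (1 - ‖ξ‖)) (hξR : R < (1 - K * (1 - ‖ξ‖)) ^ 2)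
    (hε : 0 ≤ ε) : ‖sweep μ K g ξ‖ ≤ 4 * K * ε := by
  set t := ‖ξ‖ with ht
  have ht0 : 0 ≤ t := norm_nonneg _
  have h1t : 0 < 1 - t := by linarith
  have hsub : Ioo (0 : ℝ) 1 ∩ Ici (1 - K * (1 - t)) ⊆ Ioo (0 : ℝ) 1 := inter_subset_left
  -- Since `xt ≤ x`, the kernel vanishes for `x < 1 - K(1-t)`. What remains has length at most
  -- `K(1-t)`, which cancels the growth `ε/(1-t)` of `g`.
  have hint : ∫ x in Ioo (0 : ℝ) 1, ((sweepKernel μ K t (x * t) * x : ℝ) : ℂ) *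
      g ((x : ℂ) ^ 2 * ξ) = ∫ x in Ioo (0 : ℝ) 1 ∩ Ici (1 - K * (1 - t)),
      ((sweepKernel μ K t (x * t) * x : ℝ) : ℂ) * g ((x : ℂ) ^ 2 * ξ) := by
    refine setIntegral_eq_of_subset_of_forall_sdiff_eq_zero measurableSet_Ioo hsub fun x hx => ?_
    have hx1 : x < 1 - K * (1 - t) := by
      by_contra hcon
      exact hx.2 ⟨hx.1, not_lt.1 hcon⟩
    have hxt : x * t ≤ x := mul_le_of_le_one_right hx.1.1.le hξ1.le
    rw [sweepKernel, if_neg (by linarith)]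
    simp
  have hbound : ∀ x ∈ Ioo (0 : ℝ) 1 ∩ Ici (1 - K * (1 - t)),
      ‖((sweepKernel μ K t (x * t) * x : ℝ) : ℂ) * g ((x : ℂ) ^ 2 * ξ)‖ ≤ 2 * (ε / (1 - t)) := by
    intro x hx
    have hx0 := hx.1.1
    have h1 := hμ.sweepKernel_mem hK (mul_mem_Ico hx.1 ⟨ht0, hξ1⟩) t
    rw [norm_mul, Complex.norm_real, Real.norm_of_nonneg (mul_nonneg h1.1 hx0.le)]
    by_cases hcase : 1 - x * t ≤ K * (1 - t)
    · have h2 : sweepKernel μ K t (x * t) * x ≤ 2 * 1 :=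
        mul_le_mul h1.2 hx.1.2.le hx0.le (by norm_num)
      have hw : ‖(x : ℂ) ^ 2 * ξ‖ = x ^ 2 * t := by
        rw [norm_mul, norm_pow, Complex.norm_real, Real.norm_of_nonneg hx0.le]
      have hx2 : x ^ 2 ≤ 1 := pow_le_one₀ hx0.le hx.1.2.le
      have hwt : x ^ 2 * t ≤ t := mul_le_of_le_one_left ht0 hx2
      -- On the support `xt ≥ 1 - K(1-t)`, and `x²t ≥ (xt)²`, so the argument of `g` lies in the
      -- annulus where `hg` applies.
      have hwR : R < x ^ 2 * t := by
        have h3 : (1 - K * (1 - t)) ^ 2 ≤ (x * t) ^ 2 := by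
          gcongr
          linarith
        have h4 : (x * t) ^ 2 ≤ x ^ 2 * t := by
          have : t ^ 2 ≤ t := by nlinarith
          nlinarith [sq_nonneg x]
        linarith
      have h5 := hg ((x : ℂ) ^ 2 * ξ) (by rw [hw]; exact hwR) (by rw [hw]; linarith)
      rw [hw] at h5
      have h6 : 1 - t ≤ 1 - (x ^ 2 * t) ^ 2 := by
        have h7 : 0 ≤ x ^ 2 * t := by positivity
        nlinarith
      have h8 : ‖g ((x : ℂ) ^ 2 * ξ)‖ ≤ ε / (1 - t) := by
        rw [le_div_iff₀ h1t]
        nlinarith [norm_nonneg (g ((x : ℂ) ^ 2 * ξ))]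
      exact mul_le_mul (by linarith) h8 (norm_nonneg _) (by norm_num)
    · rw [sweepKernel, if_neg hcase]
      simp only [zero_mul]
      positivity
  have hvol : volume.real (Ioo (0 : ℝ) 1 ∩ Ici (1 - K * (1 - t))) ≤ K * (1 - t) := by
    have h1 : Ioo (0 : ℝ) 1 ∩ Ici (1 - K * (1 - t)) ⊆ Icc (1 - K * (1 - t)) 1 :=
      fun x hx => ⟨hx.2, hx.1.2.le⟩
    refine (measureReal_mono h1 (by simp)).trans (le_of_eq ?_)
    rw [Real.volume_real_Icc_of_le (by nlinarith)]
    ring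
  have hmain := norm_setIntegral_le_of_norm_le_const (μ := volume)
    ((measure_mono hsub).trans_lt (by simp)) hbound
  rw [sweep, ← ht, hint, norm_mul, norm_mul, ← ht]
  have h9 : 0 ≤ 2 * (ε / (1 - t)) := by positivity
  calc ‖(2 : ℂ)‖ * t * _ ≤ 2 * 1 * (2 * (ε / (1 - t)) * (K * (1 - t))) := by
        refine mul_le_mul ?_ (hmain.trans (mul_le_mul_of_nonneg_left hvol h9))
          (norm_nonneg _) (by norm_num)
        simp [hξ1.le]
    _ = 4 * K * ε := by field_simp; ring

end IsDoublingMeasure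

lemma MemLittleBloch.exists_radius {h : ℂ → ℂ} (hh : MemLittleBloch h) {ε : ℝ} (hε : 0 < ε) :
    ∃ R < 1, ∀ z : ℂ, R < ‖z‖ → ‖z‖ < 1 → (1 - ‖z‖ ^ 2) * ‖deriv h z‖ ≤ ε := by
  have h1 := hh.2.eventually_lt_const hε
  rw [eventually_comap] at h1
  obtain ⟨R, hR, hsub⟩ := (mem_nhdsLT_iff_exists_Ioo_subset (a := (1 : ℝ))).1 h1
  exact ⟨R, hR, fun z hz1 hz2 => (hsub ⟨hz1, hz2⟩ z rfl).le⟩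

namespace IsDoublingWeight

variable {ω : ℂ → ℝ}

/-- This integral is the divisor normalizing the constant term of the preimage. -/
lemma integral_one_sub_pos {μ : Measure ℝ} (hμ : IsDoublingMeasure μ) : 0 < ∫ t, (1 - t) ∂μ := by
  have := hμ.finite
  have hnn : 0 ≤ᵐ[μ] fun t => 1 - t := hμ.ae_mem.mono fun t ht => by
    simp only [Pi.zero_apply]; linarith [ht.2]
  have hi : Integrable (fun t => 1 - t) μ :=
    hμ.integrable_of_bound (by fun_prop) 1 fun t ht => by
      rw [Real.norm_of_nonneg (by linarith [ht.2])]; linarith [ht.1]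
  refine (integral_nonneg_of_ae hnn).lt_of_ne' fun h0 => ?_
  have h1 := (integral_eq_zero_iff_of_nonneg_ae hnn hi).1 h0
  have h2 : ∀ᵐ _ ∂μ, False := by
    filter_upwards [h1, hμ.ae_mem] with t ht ht'
    simp only [Pi.zero_apply] at ht
    linarith [ht'.2]
  have h3 : μ = 0 := by simpa using h2
  have h4 := hμ.tail_pos 0 zero_lt_one
  simp [tail, h3] at h4

/-- Every function in the little Bloch space is the Bergman projection of a continuous function
that vanishes on the circle. -/
theorem exists_bergmanProjection_eq (hω : IsDoublingWeight ω) {h : ℂ → ℂ}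
    (hh : MemLittleBloch h) :
    ∃ Φ ∈ diskCZero, EqOn (bergmanProjection ω (diskExtend Φ)) h (ball 0 1) := by
  have hR := hω.toIsRadialWeight
  have hμ := hω.isDoublingMeasure
  set μ := radialMeasure ω with hμdef
  obtain ⟨K, hK1, hK⟩ := hμ.lower
  have hd : DifferentiableOn ℂ h (ball 0 1) := hh.1.1
  have hd' : DifferentiableOn ℂ (deriv h) (ball 0 1) := hd.deriv isOpen_ball
  have hI := integral_one_sub_pos hμ
  -- The radial term `c(1-|ξ|)` affects only the zeroth coefficient and vanishes on the circle; `c`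
  -- is the value that makes this coefficient equal to `h(0)`.
  set c : ℂ := taylorCoeff h 0 * (moment μ 0 / ∫ t, (1 - t) ∂μ : ℝ) with hc
  set φ : ℂ → ℂ := fun ξ => sweep μ K (deriv h) ξ + c * (1 - ‖ξ‖ : ℝ) with hφ
  have hφc : ∀ ξ ∈ ball (0 : ℂ) 1, ContinuousAt φ ξ := fun ξ hξ =>
    (hμ.continuousAt_sweep hK1 hK hd'.continuousOn hξ).add (by fun_prop)
  have hφ0 : ∀ ξ : ℂ, ‖ξ‖ = 1 → ∀ ε > 0, ∀ᶠ η in 𝓝 ξ, ‖η‖ < 1 → ‖φ η‖ < ε := by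
    intro ξ hξ ε hε
    have hK0 : 0 < K := by linarith
    obtain ⟨R, hR1, hRb⟩ := hh.exists_radius (ε := ε / 2 / (4 * K)) (by positivity)
    have h1 : ∀ᶠ η : ℂ in 𝓝 ξ, 0 < 1 - K * (1 - ‖η‖) := by
      have : ContinuousAt (fun η : ℂ => 1 - K * (1 - ‖η‖)) ξ := by fun_prop
      exact this.eventually_const_lt (by simp [hξ])
    have h2 : ∀ᶠ η : ℂ in 𝓝 ξ, R < (1 - K * (1 - ‖η‖)) ^ 2 := by
      have : ContinuousAt (fun η : ℂ => (1 - K * (1 - ‖η‖)) ^ 2) ξ := by fun_prop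
      exact this.eventually_const_lt (by simpa [hξ] using hR1)
    have h3 : ∀ᶠ η : ℂ in 𝓝 ξ, ‖c * (1 - ‖η‖ : ℝ)‖ < ε / 2 := by
      have : ContinuousAt (fun η : ℂ => ‖c * (1 - ‖η‖ : ℝ)‖) ξ := by fun_prop
      exact this.eventually_lt_const (by simpa [hξ] using hε)
    filter_upwards [h1, h2, h3] with η hη1 hη2 hη3 hη
    have h4 := hμ.norm_sweep_le hK1 hK hRb hη hη1.le hη2 (by positivity)
    have h5 : 4 * K * (ε / 2 / (4 * K)) = ε / 2 := by field_simp
    calc ‖φ η‖ ≤ ‖sweep μ K (deriv h) η‖ + ‖c * (1 - ‖η‖ : ℝ)‖ := norm_add_le _ _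
      _ < ε := by linarith
  let Φ : C(closedBall (0 : ℂ) 1, ℂ) :=
    { toFun := fun z => if ‖(z : ℂ)‖ < 1 then φ z else 0
      continuous_toFun := by
        rw [continuous_iff_continuousAt]
        intro z
        by_cases hz : ‖(z : ℂ)‖ < 1
        · have h1 : ContinuousAt (fun z : closedBall (0 : ℂ) 1 => φ z) z :=
            (hφc z (mem_ball_zero_iff.2 hz)).comp continuousAt_subtype_val
          refine h1.congr ?_
          have h2 : ContinuousAt (fun z : closedBall (0 : ℂ) 1 => ‖(z : ℂ)‖) z := by fun_prop
          filter_upwards [h2.eventually_lt_const hz] with w hw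
          rw [if_pos hw]
        · have hz1 : ‖(z : ℂ)‖ = 1 :=
            le_antisymm (mem_closedBall_zero_iff.1 z.2) (not_lt.1 hz)
          rw [ContinuousAt, if_neg hz, Metric.tendsto_nhds]
          intro ε hε
          have h1 := (continuousAt_subtype_val (x := z)).eventually (hφ0 z hz1 ε hε)
          filter_upwards [h1] with w hw
          rw [dist_zero_right]
          split_ifs with hw1
          · exact hw hw1
          · simpa using hε }
  have hΦ : ∀ ξ ∈ ball (0 : ℂ) 1, diskExtend Φ ξ = φ ξ := by
    intro ξ hξ
    rw [diskExtend_apply Φ (ball_subset_closedBall hξ)]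
    exact if_pos (mem_ball_zero_iff.1 hξ)
  refine ⟨Φ, fun z hz => if_neg (by rw [hz]; exact lt_irrefl 1), fun z hz => ?_⟩
  have hΦi := hR.integrable_diskExtend Φ
  -- These are the coefficients of `φ` on the circle of radius `t`. Index 0 carries the radial
  -- correction, since `sweep` starts at degree 1.
  set a : ℝ → ℕ → ℂ := fun t n =>
    n.casesOn (c * (1 - t : ℝ)) fun k => taylorCoeff h (k + 1) * sweepMultiplier μ K k t with ha
  have hasum : ∀ t ∈ Ioo (0 : ℝ) 1, Summable fun n => ‖a t n‖ * t ^ n := by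
    intro t ht
    have htI : t ∈ Ico (0 : ℝ) 1 := ⟨ht.1.le, ht.2⟩
    rw [← summable_nat_add_iff 1]
    refine Summable.of_nonneg_of_le (fun k => mul_nonneg (norm_nonneg _) (pow_nonneg ht.1.le _))
      (fun k => ?_) ((summable_norm_taylorCoeff hd' htI).mul_left 4)
    have h1 := hμ.abs_sweepMultiplier_le hK k htI
    have h2 : ‖taylorCoeff (deriv h) k‖ = (k + 1) * ‖taylorCoeff h (k + 1)‖ := by
      rw [taylorCoeff_deriv, norm_mul]
      congr 1
      exact_mod_cast Complex.norm_natCast (k + 1)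
    have h3 : t ^ (k + 1) ≤ t ^ k := pow_le_pow_of_le_one ht.1.le ht.2.le (by simp)
    have ht0 := ht.1
    simp only [ha]
    rw [norm_mul, Complex.norm_real, Real.norm_eq_abs, h2]
    calc ‖taylorCoeff h (k + 1)‖ * |sweepMultiplier μ K k t| * t ^ (k + 1)
        ≤ ‖taylorCoeff h (k + 1)‖ * (4 * (k + 1)) * t ^ k := by gcongr
      _ = _ := by ring
  have hfa : ∀ t ∈ Ioo (0 : ℝ) 1, ∀ θ,
      diskExtend Φ (polarPoint t θ) = ∑' n, a t n * polarPoint t θ ^ n := by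
    intro t ht θ
    have hn : ‖polarPoint t θ‖ = t := by rw [norm_polarPoint, abs_of_pos ht.1]
    have hb : polarPoint t θ ∈ ball (0 : ℂ) 1 := by rw [mem_ball_zero_iff, hn]; exact ht.2
    rw [hΦ _ hb]
    have h1 := hμ.hasSum_sweep hK hd hb
    rw [hn] at h1
    have h2 : HasSum (fun n => a t n * polarPoint t θ ^ n) (φ (polarPoint t θ)) := by
      rw [← hasSum_nat_add_iff' 1]
      convert! h1 using 1
      simp [ha, hφ, hn]
    exact h2.tsum_eq.symm
  have hcoeff : ∀ n, projCoeff ω (diskExtend Φ) n = taylorCoeff h n := by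
    intro n
    have hmn : (moment μ n : ℂ) ≠ 0 := by exact_mod_cast (hμ.moment_pos n).ne'
    have h1 : ∫ t, a t n * (t : ℂ) ^ (2 * n) ∂μ = taylorCoeff h n * moment μ n := by
      rcases n with _ | k
      · have h2 : ∀ t : ℝ, a t 0 * (t : ℂ) ^ (2 * 0) = c * ((1 - t : ℝ) : ℂ) := by
          intro t; simp [ha]
        simp_rw [h2]
        rw [integral_const_mul, integral_complex_ofReal, hc, mul_assoc, ← Complex.ofReal_mul,
          div_mul_cancel₀ _ hI.ne']
      · have h2 : ∀ t : ℝ, a t (k + 1) * (t : ℂ) ^ (2 * (k + 1)) = taylorCoeff h (k + 1) *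
            ((sweepMultiplier μ K k t * t ^ (2 * (k + 1)) : ℝ) : ℂ) := by
          intro t; simp only [ha]; push_cast; ring
        simp_rw [h2]
        rw [integral_const_mul, integral_complex_ofReal, hμ.integral_sweepMultiplier hK1 hK]
    rw [projCoeff, hR.integral_powerSeries_mul_conj_pow hΦi hasum hfa n, ← hμdef, h1]
    field_simp
  refine (hω.hasSum_bergmanProjection hΦi hz).unique ?_
  simp_rw [hcoeff]
  exact hasSum_taylorCoeff hd hz

end IsDoublingWeight

end

theorem corollary4p2 (ω : ℂ → ℝ) (hω : IsDoublingWeight ω)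
    (X : Submodule ℂ C(closedBall (0 : ℂ) 1, ℂ)) (hX : X = ⊤ ∨ X = diskCZero) :
    -- the Bergman kernel and the Bergman projection are well defined
    (∀ z ∈ ball (0 : ℂ) 1, IsReproducingKernelAt ω z (bergmanKernel ω z)) ∧
    (∀ Φ ∈ X, ∀ z ∈ ball (0 : ℂ) 1,
      Integrable (bergmanIntegrand ω (diskExtend Φ) z) diskArea) ∧
    -- `P_ω : X → B₀` is bounded
    (∃ C : ℝ≥0, ∀ Φ ∈ X,
      MemLittleBloch (bergmanProjection ω (diskExtend Φ)) ∧
      blochNorm (bergmanProjection ω (diskExtend Φ)) ≤ C * ‖Φ‖ₑ) ∧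
    -- and onto
    (∀ h : ℂ → ℂ, MemLittleBloch h →
      ∃ Φ ∈ X, EqOn (bergmanProjection ω (diskExtend Φ)) h (ball 0 1)) := by
  obtain ⟨M, hM⟩ := hω.exists_blochNorm_bergmanProjection_le
  refine ⟨fun z hz => hω.isReproducingKernelAt_bergmanKernel hz, fun Φ _ z hz =>
    hω.integrable_bergmanIntegrand (hω.toIsRadialWeight.integrable_diskExtend Φ) hz,
    ⟨M, fun Φ _ => ?_⟩, fun h hh => ?_⟩
  · have hb := hM (diskExtend Φ) ‖Φ‖₊ (continuousOn_diskExtend_ball Φ)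
      fun z hz => norm_diskExtend_le Φ hz
    refine ⟨⟨⟨hω.differentiableOn_bergmanProjection
      (hω.toIsRadialWeight.integrable_diskExtend Φ), hb.trans_lt ?_⟩,
      hω.tendsto_deriv_bergmanProjection Φ⟩, hb⟩
    exact ENNReal.mul_lt_top ENNReal.coe_lt_top ENNReal.coe_lt_top
  -- The preimage already vanishes on the circle, so it belongs to either choice of `X`.
  · obtain ⟨Φ, hΦ, heq⟩ := hω.exists_bergmanProjection_eq hh
    refine ⟨Φ, ?_, heq⟩
    rcases hX with rfl | rfl
    · trivial
    · exact hΦ
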